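/- Let $\alpha\in(0,2)$, $\lambda_+,\lambda_->0$, $\mu,\beta\in\mathbb R$ and $b>0$. For $\lambda,\lambda'>0$, $\mathrm{stdCTS}(\alpha,\lambda,\lambda')$ denotes the standardized classical tempered stable law, that is, the infinitely divisible law on $\mathbb R$ with mean $0$, no Gaussian part and Lévy measure $$\nu(dx)=\frac{e^{-\lambda x}x^{-1-\alpha}\mathbf 1_{\{x>0\}}+e^{-\lambda'|x|}|x|^{-1-\alpha}\mathbf 1_{\{x<0\}}}{\Gamma(2-\alpha)(\lambda^{\alpha-2}+\lambda'^{\alpha-2})}\,dx,$$ i.e. with characteristic function $\exp\int(e^{itx}-1-itx)\,\nu(dx)$. Let $$Y=\mu+\beta V+\sqrt V\,X$$ be mixed tempered stable: $V$ is a positive random variable and, conditionally on $V$, $X\sim\mathrm{stdCTS}(\alpha,\lambda_+\sqrt V,\lambda_-\sqrt V)$. For $u\in[-\lambda_-,\lambda_+]$ let $$\Phi_H(u)=\frac{(\lambda_+-u)^\alpha-\lambda_+^\alpha+(\lambda_-+u)^\alpha-\lambda_-^\alpha}{\alpha(\alpha-1)(\lambda_+^{\alpha-2}+\lambda_-^{\alpha-2})}+\frac{(\lambda_+^{\alpha-1}-\lambda_-^{\alpha-1})u}{(\alpha-1)(\lambda_+^{\alpha-2}+\lambda_-^{\alpha-2})}$$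 be the cumulant generating function of $H\sim\mathrm{stdCTS}(\alpha,\lambda_+,\lambda_-)$, where for $\alpha=1$ the right-hand side is understood as its limit $$\Phi_H(u)=\frac{(\lambda_+-u)\log\frac{\lambda_+-u}{\lambda_+}+(\lambda_-+u)\log\frac{\lambda_-+u}{\lambda_-}}{\lambda_+^{-1}+\lambda_-^{-1}}\qquad(0\log 0=0).$$ The fundamental strip of a real random variable $Z$ is the set of $u\in\mathbb C$ with $E[|e^{uZ}|]<\infty$. Suppose that $V$ has fundamental strip $\{\operatorname{Re}(u)<b\}$; this is the case, for example, if $V\sim\Gamma(a,b)$ with shape $a>0$ and rate $b$. Then: 1. If $\max\{-\beta\lambda_-+\Phi_H(-\lambda_-),\ \beta\lambda_++\Phi_H(\lambda_+)\}<b$, then $Y$ has fundamental strip $-\lambda_-\le\operatorname{Re}(u)\le\lambda_+$. 2. If $-\beta\lambda_-+\Phi_H(-\lambda_-)<b<\beta\lambda_++\Phi_H(\lambda_+)$, then the equation $\beta u+\Phi_H(u)=b$ has a unique real solution $u_+\in[-\lambda_-,\lambda_+]$, and $Y$ has fundamental strip $-\lambda_-\le\operatorname{Re}(u)<u_+$.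 3. If $-\beta\lambda_-+\Phi_H(-\lambda_-)>b>\beta\lambda_++\Phi_H(\lambda_+)$, then the equation $\beta u+\Phi_H(u)=b$ has a unique real solution $u_-\in[-\lambda_-,\lambda_+]$, and $Y$ has fundamental strip $u_-<\operatorname{Re}(u)\le\lambda_+$. 4. If $b<\min\{-\beta\lambda_-+\Phi_H(-\lambda_-),\ \beta\lambda_++\Phi_H(\lambda_+)\}$, then the equation $\beta u+\Phi_H(u)=b$ has exactly two real solutions $u_-<u_+$ in $[-\lambda_-,\lambda_+]$, and $Y$ has fundamental strip $u_-<\operatorname{Re}(u)<u_+$. -/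

import Mathlib

open MeasureTheory ProbabilityTheory

namespace MixedTS

noncomputable section

/-- The fundamental strip of a random variable `Z`: all `u ∈ ℂ` with `E[|e^{uZ}|] < ∞`. -/
def fundamentalStrip {Ω : Type*} [MeasurableSpace Ω] (P : Measure Ω) (Z : Ω → ℝ) : Set ℂ :=
  {u : ℂ | ∫⁻ ω, ‖Complex.exp (u * (Z ω : ℂ))‖ₑ ∂P < ⊤}

/-- The density of the Lévy measure of a classical tempered stable law with stability index `α`,
tempering parameters `lp` (right tail) and `lm` (left tail), and scales `cp`, `cm`. -/
def ctsLevyDensity (α lp lm cp cm x : ℝ) : ℝ :=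
  if 0 < x then cp * Real.exp (-lp * x) * x ^ (-1 - α)
  else if x < 0 then cm * Real.exp (-lm * |x|) * |x| ^ (-1 - α)
  else 0

/-- The Lévy–Khintchine exponent of the classical tempered stable law with mean `m`:
`i t m + ∫ (e^{itx} - 1 - itx) ν(dx)`. -/
def ctsCharExponent (α lp lm cp cm m t : ℝ) : ℂ :=
  Complex.I * (t : ℂ) * (m : ℂ) +
    ∫ x : ℝ, (Complex.exp (Complex.I * (t : ℂ) * (x : ℂ)) - 1 - Complex.I * (t : ℂ) * (x : ℂ))
      * (ctsLevyDensity α lp lm cp cm x : ℂ)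

/-- `ρ` is the classical tempered stable law `CTS(α, lp, lm, cp, cm, m)`: the infinitely divisible
law without Gaussian part, with mean `m` and the above Lévy measure (`0 < α < 2`). -/
def IsCTS (α lp lm cp cm m : ℝ) (ρ : Measure ℝ) : Prop :=
  IsProbabilityMeasure ρ ∧
    ∀ t : ℝ, charFun ρ t = Complex.exp (ctsCharExponent α lp lm cp cm m t)

/-- The scale that gives the law unit variance. -/
def stdScale (α lp lm : ℝ) : ℝ :=
  1 / (Real.Gamma (2 - α) * (lp ^ (α - 2) + lm ^ (α - 2)))

/-- `ρ` is the standardized classical tempered stable law `stdCTS(α, lp, lm)`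
(mean `0`, variance `1`). -/
def IsStdCTS (α lp lm : ℝ) (ρ : Measure ℝ) : Prop :=
  IsCTS α lp lm (stdScale α lp lm) (stdScale α lp lm) 0 ρ

/-- `Y = μ + β V + √V X` is mixed tempered stable, with mixing variable `V > 0` and
`X | V ∼ stdCTS(α, lp √V, lm √V)`. -/
structure IsMixedTS {Ω : Type*} [MeasurableSpace Ω] (P : Measure Ω) [IsProbabilityMeasure P]
    (μ β α lp lm : ℝ) (V X Y : Ω → ℝ) : Prop where
  measurable_V : Measurable V
  measurable_X : Measurable X
  pos_V : ∀ᵐ ω ∂P, 0 < V ω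
  cond_X : ∀ᵐ v ∂(P.map V), IsStdCTS α (lp * √v) (lm * √v) (condDistrib X V P v)
  eq_Y : ∀ᵐ ω ∂P, Y ω = μ + β * V ω + √(V ω) * X ω

/-- The cumulant generating function `Φ_H` of `H ∼ stdCTS(α, lp, lm)` at real `u ∈ [-lm, lp]`.
At `α = 1`, where the general expression reads `0 / 0`, it is its limit as `α → 1`
(`Real.log 0 = 0` gives the correct values at `u = lp` and `u = -lm`). -/
def PhiH (α lp lm u : ℝ) : ℝ :=
  if α = 1 then
    ((lp - u) * Real.log ((lp - u) / lp) + (lm + u) * Real.log ((lm + u) / lm))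
      / (lp⁻¹ + lm⁻¹)
  else
    ((lp - u) ^ α - lp ^ α + (lm + u) ^ α - lm ^ α)
        / (α * (α - 1) * (lp ^ (α - 2) + lm ^ (α - 2)))
      + (lp ^ (α - 1) - lm ^ (α - 1)) * u
        / ((α - 1) * (lp ^ (α - 2) + lm ^ (α - 2)))

/-- The real solutions of `β u + Φ_H(u) = b` in the domain `[-lm, lp]` of `Φ_H`. -/
def realSolutions (β α lp lm b : ℝ) : Set ℝ :=
  {u : ℝ | u ∈ Set.Icc (-lm) lp ∧ β * u + PhiH α lp lm u = b}

end

end MixedTS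

/- Conditionally on `V = v`, the variable `√v X` has Lévy measure `v ν`, where `ν` is the Lévy
measure of `H`: the tempering parameters `λ± √v` are chosen for exactly this. Hence its cumulant
generating function is `v Φ_H` on `[-λ₋, λ₊]`. Outside this interval its exponential moments are
infinite, since `Φ_H''` blows up at the end points whereas a cumulant generating function is
analytic in the interior of its domain. Integrating out `V`,
`E[e^{sY}] = e^{μ s} E[e^{(β s + Φ_H(s)) V}]` for `s ∈ [-λ₋, λ₊]`, so the real trace of the
fundamental strip of `Y` is the sublevel set `{β s + Φ_H(s) < b}` of a convex function that takes
the value `0 < b` at `s = 0`.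

To pass from the characteristic function of a law with Lévy measure `ν` to its exponential moments,
the law is recovered as a weak limit of centred compound Poisson laws, obtained by cutting off the
small jumps, whose exponential moments are explicit power series. -/

namespace MixedTS

open Filter Set Topology
open scoped ENNReal NNReal

section ExtendedMGF

variable {Ω : Type*} [MeasurableSpace Ω] {P : Measure Ω} {X Y : Ω → ℝ} {s t : ℝ}

/-- The moment generating function of `X` under `P` as an extended nonnegative number. Unlike
`ProbabilityTheory.mgf` it is `⊤`, rather than the junk value `0`, where `exp (s * X)` is not
integrable. -/
noncomputable def emgf (X : Ω → ℝ) (P : Measure Ω) (s : ℝ) : ℝ≥0∞ :=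
  ∫⁻ ω, ENNReal.ofReal (Real.exp (s * X ω)) ∂P

theorem emgf_congr_ae (h : X =ᵐ[P] Y) : emgf X P = emgf Y P :=
  funext fun _ => lintegral_congr_ae <| h.mono fun ω hω => by simp only [hω]

theorem emgf_id_map (hX : AEMeasurable X P) : emgf id (P.map X) = emgf X P :=
  funext fun _ => lintegral_map' (by fun_prop) hX

theorem emgf_neg : emgf (-X) P s = emgf X P (-s) := by
  simp only [emgf, Pi.neg_apply, mul_neg, neg_mul]

theorem emgf_add_const (hX : AEMeasurable X P) (c : ℝ) :
    emgf (fun ω => X ω + c) P s = emgf X P s * ENNReal.ofReal (Real.exp (s * c)) := by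
  simp_rw [emgf, mul_add, Real.exp_add, ENNReal.ofReal_mul (Real.exp_nonneg _)]
  exact lintegral_mul_const'' _ (by fun_prop)

theorem emgf_lt_top_iff (hX : AEMeasurable X P) :
    emgf X P s < ⊤ ↔ s ∈ integrableExpSet X P :=
  lt_top_iff_ne_top.trans <|
    lintegral_ofReal_ne_top_iff_integrable (by fun_prop) (ae_of_all _ fun _ => Real.exp_nonneg _)

theorem emgf_eq_ofReal_mgf (h : s ∈ integrableExpSet X P) :
    emgf X P s = ENNReal.ofReal (mgf X P s) :=
  (ofReal_integral_eq_lintegral_ofReal h (ae_of_all _ fun _ => Real.exp_nonneg _)).symm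

theorem mgf_eq_toReal_emgf (hX : AEMeasurable X P) : mgf X P s = (emgf X P s).toReal :=
  integral_eq_lintegral_of_nonneg_ae (ae_of_all _ fun _ => Real.exp_nonneg _) (by fun_prop)

theorem mem_fundamentalStrip_iff {u : ℂ} : u ∈ fundamentalStrip P X ↔ emgf X P u.re < ⊤ := by
  have h : ∀ ω, ‖Complex.exp (u * (X ω : ℂ))‖ₑ = ENNReal.ofReal (Real.exp (u.re * X ω)) :=
    fun ω => by rw [← ofReal_norm, Complex.norm_exp, Complex.re_mul_ofReal]
  simp only [fundamentalStrip, mem_ofPred_eq, h, emgf]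

theorem tendsto_emgf_mul_left [IsFiniteMeasure P] (hX : AEMeasurable X P) :
    Tendsto (fun r => emgf X P (r * s)) (𝓝[<] 1) (𝓝 (emgf X P s)) := by
  have hpt : ∀ ω, Tendsto (fun r : ℝ => ENNReal.ofReal (Real.exp (r * s * X ω))) (𝓝[<] 1)
      (𝓝 (ENNReal.ofReal (Real.exp (s * X ω)))) := fun ω => by
    have hc : Continuous fun r : ℝ => ENNReal.ofReal (Real.exp (r * s * X ω)) :=
      ENNReal.continuous_ofReal.comp (by fun_prop)
    simpa only [one_mul] using (hc.tendsto 1).mono_left nhdsWithin_le_nhds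
  have hmeas : ∀ r : ℝ, AEMeasurable (fun ω => ENNReal.ofReal (Real.exp (r * s * X ω))) P :=
    fun r => by fun_prop
  rcases eq_or_ne (emgf X P s) ⊤ with htop | hfin
  · refine tendsto_of_le_liminf_of_limsup_le ?_ (htop ▸ le_top)
    calc emgf X P s
        = ∫⁻ ω, liminf (fun r : ℝ => ENNReal.ofReal (Real.exp (r * s * X ω))) (𝓝[<] 1) ∂P :=
          lintegral_congr fun ω => (hpt ω).liminf_eq.symm
      _ ≤ liminf (fun r => emgf X P (r * s)) (𝓝[<] 1) := lintegral_liminf_le' hmeas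
  · refine tendsto_lintegral_filter_of_dominated_convergence'
      (fun ω => 1 + ENNReal.ofReal (Real.exp (s * X ω))) (.of_forall hmeas) ?_ ?_ (ae_of_all _ hpt)
    · filter_upwards [Ioo_mem_nhdsLT (zero_lt_one (α := ℝ))] with r hr
      refine ae_of_all _ fun ω => ?_
      rcases le_total 0 (s * X ω) with h | h
      · exact le_add_left (ENNReal.ofReal_le_ofReal (Real.exp_le_exp.2 (by nlinarith [hr.2])))
      · exact le_add_right (ENNReal.ofReal_le_one.2 (Real.exp_le_one_iff.2 (by nlinarith [hr.1])))
    · rw [lintegral_add_left measurable_const, lintegral_one]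
      exact ENNReal.add_ne_top.2 ⟨measure_ne_top P univ, hfin⟩

end ExtendedMGF

section CompoundPoisson

variable (η : Measure ℝ)

/-- The `n`-th power of a measure on `ℝ` under convolution. -/
noncomputable def convPow : ℕ → Measure ℝ
  | 0 => Measure.dirac 0
  | n + 1 => convPow n ∗ η

/-- The compound Poisson law with finite jump measure `η`: the sum of a Poisson number, of mean the
total mass of `η`, of independent jumps distributed as the normalization of `η`. -/
noncomputable def compoundPoisson : Measure ℝ :=
  Measure.sum fun n : ℕ =>
    ENNReal.ofReal (Real.exp (-η.real univ) / n.factorial) • convPow η n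

/-- The compound Poisson law with jump measure `η`, translated so as to have mean zero. -/
noncomputable def centredCompoundPoisson : Measure ℝ :=
  (compoundPoisson η).map (· + -∫ x, x ∂η)

variable [IsFiniteMeasure η]

instance isFiniteMeasure_convPow (n : ℕ) : IsFiniteMeasure (convPow η n) := by
  induction n with
  | zero => unfold convPow; infer_instance
  | succ n ih => unfold convPow; infer_instance

theorem charFun_convPow (n : ℕ) (t : ℝ) : charFun (convPow η n) t = charFun η t ^ n := by
  induction n with
  | zero => rw [convPow, charFun_dirac, inner_zero_left, Complex.ofReal_zero, zero_mul,
      Complex.exp_zero, pow_zero]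
  | succ n ih => rw [convPow, charFun_conv, ih, pow_succ]

theorem emgf_convPow (n : ℕ) (s : ℝ) : emgf id (convPow η n) s = emgf id η s ^ n := by
  have hmeas : Measurable fun x : ℝ => ENNReal.ofReal (Real.exp (s * id x)) := by fun_prop
  induction n with
  | zero => rw [convPow, emgf, lintegral_dirac' _ hmeas, id, mul_zero, Real.exp_zero,
      ENNReal.ofReal_one, pow_zero]
  | succ n ih =>
    rw [convPow, emgf, Measure.lintegral_conv hmeas, pow_succ, ← ih, emgf, emgf,
      ← lintegral_mul_const _ hmeas]
    refine lintegral_congr fun x => ?_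
    rw [← lintegral_const_mul _ hmeas]
    simp only [id, mul_add, Real.exp_add, ENNReal.ofReal_mul (Real.exp_nonneg _)]

theorem emgf_compoundPoisson {s : ℝ} (hs : s ∈ integrableExpSet id η) :
    emgf id (compoundPoisson η) s = ENNReal.ofReal (Real.exp (mgf id η s - η.real univ)) := by
  have hexp : HasSum (fun n : ℕ => Real.exp (-η.real univ) * (mgf id η s ^ n / n.factorial))
      (Real.exp (-η.real univ) * Real.exp (mgf id η s)) := by
    rw [Real.exp_eq_exp_ℝ]
    exact (NormedSpace.expSeries_div_hasSum_exp (mgf id η s)).mul_left _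
  have hmgf : 0 ≤ mgf id η s := mgf_nonneg
  calc emgf id (compoundPoisson η) s
      = ∑' n : ℕ, ENNReal.ofReal (Real.exp (-η.real univ) / n.factorial) *
          emgf id (convPow η n) s := by
        rw [emgf, compoundPoisson, lintegral_sum_measure]
        simp_rw [lintegral_smul_measure, smul_eq_mul, emgf]
    _ = ∑' n : ℕ, ENNReal.ofReal (Real.exp (-η.real univ) * (mgf id η s ^ n / n.factorial)) := by
        refine tsum_congr fun n => ?_
        rw [emgf_convPow, emgf_eq_ofReal_mgf hs, ← ENNReal.ofReal_pow hmgf,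
          ← ENNReal.ofReal_mul (by positivity), div_mul_eq_mul_div, mul_div_assoc]
    _ = ENNReal.ofReal (Real.exp (mgf id η s - η.real univ)) := by
        rw [← ENNReal.ofReal_tsum_of_nonneg (fun n => by positivity) hexp.summable, hexp.tsum_eq,
          sub_eq_neg_add, Real.exp_add]

instance isProbabilityMeasure_compoundPoisson : IsProbabilityMeasure (compoundPoisson η) := by
  have h := emgf_compoundPoisson η (s := 0) (by simp [integrableExpSet])
  exact ⟨by simpa [emgf] using h⟩

theorem charFun_compoundPoisson (t : ℝ) :
    charFun (compoundPoisson η) t = Complex.exp (charFun η t - η.real univ) := by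
  have hint : Integrable (fun x : ℝ => Complex.exp (t * x * Complex.I)) (compoundPoisson η) := by
    refine Integrable.of_bound (C := 1) (by fun_prop) (ae_of_all _ fun x => ?_)
    rw [← Complex.ofReal_mul, Complex.norm_exp_ofReal_mul_I]
  have hexp : HasSum (fun n : ℕ => Complex.exp (-η.real univ) * (charFun η t ^ n / n.factorial))
      (Complex.exp (-η.real univ) * Complex.exp (charFun η t)) := by
    rw [Complex.exp_eq_exp_ℂ]
    exact (NormedSpace.expSeries_div_hasSum_exp (charFun η t)).mul_left _
  calc charFun (compoundPoisson η) t
      = ∑' n : ℕ, (ENNReal.ofReal (Real.exp (-η.real univ) / n.factorial)).toReal •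
          charFun (convPow η n) t := by
        simp_rw [charFun_apply_real, ← integral_smul_measure]
        exact (hasSum_integral_measure hint).tsum_eq.symm
    _ = ∑' n : ℕ, Complex.exp (-η.real univ) * (charFun η t ^ n / n.factorial) := by
        refine tsum_congr fun n => ?_
        rw [charFun_convPow, ENNReal.toReal_ofReal (by positivity), Complex.real_smul]
        push_cast
        ring
    _ = Complex.exp (charFun η t - η.real univ) := by
        rw [hexp.tsum_eq, sub_eq_neg_add, Complex.exp_add]

instance isProbabilityMeasure_centredCompoundPoisson :
    IsProbabilityMeasure (centredCompoundPoisson η) :=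
  Measure.isProbabilityMeasure_map (by fun_prop)

end CompoundPoisson

section LevyExponent

variable {η ν : Measure ℝ} {s : ℝ}

/-- The Lévy–Khintchine exponent `∫ (e^{itx} - 1 - itx) ν(dx)` of the infinitely divisible law with
mean zero, no Gaussian part and Lévy measure `ν`. -/
noncomputable def levyExponent (ν : Measure ℝ) (t : ℝ) : ℂ :=
  ∫ x : ℝ, (Complex.exp (Complex.I * t * x) - 1 - Complex.I * t * x) ∂ν

/-- The cumulant generating function `∫ (e^{sx} - 1 - sx) ν(dx)` of the infinitely divisible law
with mean zero, no Gaussian part and Lévy measure `ν`. -/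
noncomputable def levyCgf (ν : Measure ℝ) (s : ℝ) : ℝ :=
  ∫ x : ℝ, (Real.exp (s * x) - 1 - s * x) ∂ν

/-- The domain of `levyCgf ν`: the integral defining it has the junk value `0` elsewhere. -/
def levyCgfDomain (ν : Measure ℝ) : Set ℝ :=
  {s | Integrable (fun x : ℝ => Real.exp (s * x) - 1 - s * x) ν}

theorem levyExponent_smul (c : ℝ≥0) (t : ℝ) :
    levyExponent (c • ν) t = c * levyExponent ν t := by
  rw [levyExponent, integral_smul_nnreal_measure, NNReal.smul_def, Complex.real_smul, levyExponent]

theorem levyCgf_smul (c : ℝ≥0) (s : ℝ) :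
    levyCgf (c • ν) s = c * levyCgf ν s := by
  rw [levyCgf, integral_smul_nnreal_measure, NNReal.smul_def, smul_eq_mul, levyCgf]

theorem levyCgfDomain_subset_smul (c : ℝ≥0) :
    levyCgfDomain ν ⊆ levyCgfDomain (c • ν) :=
  fun _ hs => hs.smul_measure_nnreal

theorem charFun_centredCompoundPoisson [IsFiniteMeasure η] (hη : Integrable (fun x : ℝ => x) η)
    (t : ℝ) : charFun (centredCompoundPoisson η) t = Complex.exp (levyExponent η t) := by
  have hexp : Integrable (fun x : ℝ => Complex.exp (Complex.I * t * x)) η := by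
    refine Integrable.of_bound (C := 1) (by fun_prop) (ae_of_all _ fun x => ?_)
    rw [mul_assoc, ← Complex.ofReal_mul, mul_comm, Complex.norm_exp_ofReal_mul_I]
  have hlin : Integrable (fun x : ℝ => Complex.I * t * (x : ℂ)) η :=
    (hη.ofReal (𝕜 := ℂ)).const_mul _
  have hone : Integrable (fun _ : ℝ => (1 : ℂ)) η := integrable_const _
  have hdiff : Integrable (fun x : ℝ => Complex.exp (Complex.I * t * x) - 1) η := hexp.sub hone
  have hsplit : levyExponent η t = charFun η t - η.real univ - Complex.I * t * ∫ x, x ∂η := by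
    rw [levyExponent, integral_sub hdiff hlin, integral_sub hexp hone,
      integral_const_mul, integral_const, charFun_apply_real, integral_complex_ofReal]
    simp only [mul_comm Complex.I, mul_right_comm _ Complex.I, Complex.real_smul, mul_one]
  rw [centredCompoundPoisson, charFun_map_add_const, charFun_compoundPoisson, ← Complex.exp_add,
    hsplit]
  congr 1
  simp only [RCLike.inner_apply, conj_trivial]
  push_cast
  ring

theorem emgf_centredCompoundPoisson [IsFiniteMeasure η] (hη : Integrable (fun x : ℝ => x) η)
    (hs : s ∈ levyCgfDomain η) :
    emgf id (centredCompoundPoisson η) s = ENNReal.ofReal (Real.exp (levyCgf η s)) := by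
  have hlin : Integrable (fun x : ℝ => s * x) η := hη.const_mul s
  have hone : Integrable (fun _ : ℝ => (1 : ℝ)) η := integrable_const _
  have hexp : Integrable (fun x : ℝ => Real.exp (s * x)) η :=
    ((hs.add hlin).add hone).congr (ae_of_all _ fun x => by simp only [Pi.add_apply]; ring)
  have hdiff : Integrable (fun x : ℝ => Real.exp (s * x) - 1) η := hexp.sub hone
  have hsplit : levyCgf η s = mgf id η s - η.real univ + s * -∫ x, x ∂η := by
    rw [levyCgf, integral_sub hdiff hlin, integral_sub hexp hone, integral_const_mul,
      integral_const, smul_eq_mul, mul_one, mgf, mul_neg, sub_eq_add_neg]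
    rfl
  calc emgf id (centredCompoundPoisson η) s
      = emgf id (compoundPoisson η) s * ENNReal.ofReal (Real.exp (s * -∫ x, x ∂η)) := by
        rw [centredCompoundPoisson, emgf_id_map (by fun_prop)]
        exact emgf_add_const aemeasurable_id _
    _ = ENNReal.ofReal (Real.exp (levyCgf η s)) := by
        rw [emgf_compoundPoisson η hexp, ← ENNReal.ofReal_mul (Real.exp_nonneg _),
          ← Real.exp_add, hsplit]

end LevyExponent

section WeakConvergence

variable {E : Type*} [TopologicalSpace E] [MeasurableSpace E] [OpensMeasurableSpace E]
  {ι : Type*} {l : Filter ι} {ρs : ι → ProbabilityMeasure E} {ρ : ProbabilityMeasure E}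
  {f : E → ℝ≥0}

theorem tendsto_lintegral_min (h : Tendsto ρs l (𝓝 ρ)) (hf : Continuous f) (K : ℝ≥0) :
    Tendsto (fun i => ∫⁻ x, min (f x) K ∂(ρs i : Measure E)) l
      (𝓝 (∫⁻ x, min (f x) K ∂(ρ : Measure E))) := by
  let g : BoundedContinuousFunction E ℝ≥0 :=
    .mkOfBound ⟨fun x => min (f x) K, by fun_prop⟩ K fun x y =>
      abs_sub_le_of_nonneg_of_le (NNReal.coe_nonneg _) (NNReal.coe_le_coe.2 (min_le_right _ _))
        (NNReal.coe_nonneg _) (NNReal.coe_le_coe.2 (min_le_right _ _))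
  exact ProbabilityMeasure.tendsto_iff_forall_lintegral_tendsto.1 h g

theorem lintegral_le_liminf_lintegral (h : Tendsto ρs l (𝓝 ρ)) (hf : Continuous f) [l.NeBot] :
    ∫⁻ x, f x ∂(ρ : Measure E) ≤ liminf (fun i => ∫⁻ x, f x ∂(ρs i : Measure E)) l := by
  have htrunc : Tendsto (fun K : ℕ => ∫⁻ x, min (f x) (K : ℝ≥0) ∂(ρ : Measure E)) atTop
      (𝓝 (∫⁻ x, f x ∂(ρ : Measure E))) := by
    refine lintegral_tendsto_of_tendsto_of_monotone
      (fun K => (hf.measurable.min measurable_const).coe_nnreal_ennreal.aemeasurable)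
      (ae_of_all _ fun x i j hij => ?_) (ae_of_all _ fun x => ?_)
    · exact ENNReal.coe_le_coe.2 (min_le_min_left _ (Nat.cast_le.2 hij))
    · refine tendsto_const_nhds.congr' ?_
      filter_upwards [eventually_ge_atTop ⌈f x⌉₊] with K hK
      rw [min_eq_left (ENNReal.coe_le_coe.2 (Nat.ceil_le.1 hK))]
  refine le_of_tendsto' htrunc fun K => ?_
  rw [← (tendsto_lintegral_min h hf K).liminf_eq]
  exact liminf_le_liminf (.of_forall fun i => lintegral_mono fun x =>
    ENNReal.coe_le_coe.2 (min_le_left _ _))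

theorem le_min_add_rpow_mul {p : ℝ} (hp : 1 < p) (a : ℝ≥0) {K : ℝ≥0} (hK : 0 < K) :
    a ≤ min a K + K ^ (1 - p) * a ^ p := by
  rcases le_total a K with h | h
  · exact (min_eq_left h).symm ▸ le_self_add
  · have ha : 0 < a := hK.trans_le h
    calc a = a ^ (1 - p) * a ^ p := by rw [← NNReal.rpow_add ha.ne']; simp
      _ ≤ K ^ (1 - p) * a ^ p := by
        gcongr ?_ * _
        exact Real.rpow_le_rpow_of_nonpos (NNReal.coe_pos.2 hK) h (sub_nonpos.2 hp.le)
      _ ≤ min a K + K ^ (1 - p) * a ^ p := le_add_self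

/- A bound on a moment of order `p > 1` makes the mass of `f` above the level `K` at most
`K ^ (1 - p)` times that bound, uniformly along the sequence. -/
theorem tendsto_lintegral_of_lintegral_rpow_le [l.NeBot] (h : Tendsto ρs l (𝓝 ρ))
    (hf : Continuous f) {p : ℝ} (hp : 1 < p) {C : ℝ≥0∞} (hC : C ≠ ⊤)
    (hbound : ∀ᶠ i in l, ∫⁻ x, (f x : ℝ≥0∞) ^ p ∂(ρs i : Measure E) ≤ C) :
    Tendsto (fun i => ∫⁻ x, f x ∂(ρs i : Measure E)) l (𝓝 (∫⁻ x, f x ∂(ρ : Measure E))) := by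
  have hlimsup : ∀ K : ℝ≥0, 0 < K → limsup (fun i => ∫⁻ x, f x ∂(ρs i : Measure E)) l ≤
      ∫⁻ x, f x ∂(ρ : Measure E) + (K ^ (1 - p) : ℝ≥0) * C := fun K hK => by
    calc limsup (fun i => ∫⁻ x, f x ∂(ρs i : Measure E)) l
        ≤ limsup (fun i => ∫⁻ x, min (f x) K ∂(ρs i : Measure E) + (K ^ (1 - p) : ℝ≥0) * C) l := by
          refine limsup_le_limsup (hbound.mono fun i hi => ?_)
          have hfp : Measurable fun x => (f x : ℝ≥0∞) ^ p := by fun_prop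
          refine le_trans ?_ (add_le_add_right (mul_le_mul_right hi _) _)
          rw [← lintegral_const_mul _ hfp, ← lintegral_add_right _ (hfp.const_mul _)]
          refine lintegral_mono fun x => ?_
          rw [← ENNReal.coe_rpow_of_nonneg _ (by linarith)]
          simpa only [ENNReal.coe_add, ENNReal.coe_mul, ENNReal.coe_min] using
            ENNReal.coe_le_coe.2 (le_min_add_rpow_mul hp (f x) hK)
      _ = ∫⁻ x, min (f x) K ∂(ρ : Measure E) + (K ^ (1 - p) : ℝ≥0) * C :=
          ((tendsto_lintegral_min h hf K).add tendsto_const_nhds).limsup_eq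
      _ ≤ ∫⁻ x, f x ∂(ρ : Measure E) + (K ^ (1 - p) : ℝ≥0) * C := by
          gcongr with x
          exact min_le_left _ _
  have htail : Tendsto (fun K : ℝ≥0 => ((K ^ (1 - p) : ℝ≥0) : ℝ≥0∞) * C) atTop (𝓝 0) := by
    have hpow : Tendsto (fun K : ℝ≥0 => K ^ (1 - p)) atTop (𝓝 0) := by
      rw [← NNReal.tendsto_coe, ← neg_sub p 1]
      exact (tendsto_rpow_neg_atTop (sub_pos.2 hp)).comp (NNReal.tendsto_coe_atTop.2 tendsto_id)
    simpa using ENNReal.Tendsto.mul_const (ENNReal.tendsto_coe.2 hpow) (.inr hC)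
  refine tendsto_of_le_liminf_of_limsup_le (lintegral_le_liminf_lintegral h hf) ?_
  simpa only [add_zero] using ge_of_tendsto (tendsto_const_nhds.add htail)
    ((eventually_gt_atTop 0).mono hlimsup)

end WeakConvergence

section SmallJumpTruncation

variable {ν ρ : Measure ℝ} {s : ℝ}

/-- The jumps of size larger than `1 / (n + 1)`, of which a Lévy measure has only finite mass. -/
def bigJumps (n : ℕ) : Set ℝ := {x | 1 / ((n : ℝ) + 1) < |x|}

theorem measurableSet_bigJumps (n : ℕ) : MeasurableSet (bigJumps n) :=
  measurableSet_lt measurable_const (by fun_prop)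

theorem monotone_bigJumps : Monotone bigJumps := fun _ n hmn x hx =>
  show 1 / ((n : ℝ) + 1) < |x| from (Nat.one_div_le_one_div hmn).trans_lt hx

theorem iUnion_bigJumps : ⋃ n, bigJumps n = {0}ᶜ := by
  ext x
  simp only [mem_iUnion, mem_compl_singleton_iff, ← abs_pos]
  exact ⟨fun ⟨n, hn⟩ => lt_trans (by positivity) hn, fun hx => exists_nat_one_div_lt hx⟩

theorem tendsto_setIntegral_bigJumps {E : Type*} [NormedAddCommGroup E] [NormedSpace ℝ E]
    {f : ℝ → E} (hf : Integrable f ν) (h0 : f 0 = 0) :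
    Tendsto (fun n => ∫ x in bigJumps n, f x ∂ν) atTop (𝓝 (∫ x, f x ∂ν)) := by
  have h := tendsto_setIntegral_of_monotone measurableSet_bigJumps monotone_bigJumps
    (hf.integrableOn (s := ⋃ n, bigJumps n))
  rwa [iUnion_bigJumps, setIntegral_eq_integral_of_forall_compl_eq_zero fun x hx => by
    rwa [notMem_compl_iff.1 hx]] at h

theorem isFiniteMeasure_restrict_bigJumps (hν : Integrable (fun x : ℝ => x ^ 2) ν) (n : ℕ) :
    IsFiniteMeasure (ν.restrict (bigJumps n)) := by
  refine isFiniteMeasure_restrict.2 (ne_of_lt ?_)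
  refine (measure_mono fun x hx => ?_).trans_lt
    (hν.measure_norm_ge_lt_top (ε := (1 / ((n : ℝ) + 1)) ^ 2) (by positivity))
  exact (pow_le_pow_left₀ (by positivity) (le_of_lt hx) 2).trans_eq (abs_pow x 2).symm

theorem integrableOn_id_bigJumps (hν : Integrable (fun x : ℝ => x ^ 2) ν) (n : ℕ) :
    IntegrableOn (fun x : ℝ => x) (bigJumps n) ν := by
  refine Integrable.mono' (hν.integrableOn.const_mul ((n : ℝ) + 1)) (by fun_prop)
    ((ae_restrict_iff' (measurableSet_bigJumps n)).2 (ae_of_all _ fun x hx => ?_))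
  have hx' : 1 < |x| * ((n : ℝ) + 1) := (div_lt_iff₀ (by positivity)).1 hx
  rw [Real.norm_eq_abs, ← sq_abs]
  nlinarith [abs_nonneg x]

theorem norm_cexp_I_mul_sub_one_sub_le (y : ℝ) :
    ‖Complex.exp (Complex.I * y) - 1 - Complex.I * y‖ ≤ 3 * y ^ 2 := by
  have hI : ‖Complex.I * (y : ℂ)‖ = |y| := by simp
  rcases le_or_gt |y| 1 with h | h
  · have := Complex.norm_exp_sub_one_sub_id_le (hI.trans_le h)
    rw [hI, sq_abs] at this
    nlinarith [sq_nonneg y]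
  · calc ‖Complex.exp (Complex.I * y) - 1 - Complex.I * y‖
        ≤ ‖Complex.exp (Complex.I * y)‖ + ‖(1 : ℂ)‖ + ‖Complex.I * (y : ℂ)‖ :=
          (norm_sub_le _ _).trans (by gcongr; exact norm_sub_le _ _)
      _ = 2 + |y| := by rw [mul_comm Complex.I, Complex.norm_exp_ofReal_mul_I, norm_one,
          mul_comm _ Complex.I, hI]; ring
      _ ≤ 3 * y ^ 2 := by rw [← sq_abs]; nlinarith

theorem integrable_levyExponent (hν : Integrable (fun x : ℝ => x ^ 2) ν) (t : ℝ) :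
    Integrable (fun x : ℝ => Complex.exp (Complex.I * t * x) - 1 - Complex.I * t * x) ν := by
  refine (hν.const_mul (3 * t ^ 2)).mono' (by fun_prop) (ae_of_all _ fun x => ?_)
  calc ‖Complex.exp (Complex.I * t * x) - 1 - Complex.I * t * x‖
      = ‖Complex.exp (Complex.I * (t * x : ℝ)) - 1 - Complex.I * (t * x : ℝ)‖ := by
        simp only [Complex.ofReal_mul, mul_assoc]
    _ ≤ 3 * (t * x) ^ 2 := norm_cexp_I_mul_sub_one_sub_le _
    _ = 3 * t ^ 2 * x ^ 2 := by ring

theorem tendsto_levyExponent_restrict_bigJumps (hν : Integrable (fun x : ℝ => x ^ 2) ν) (t : ℝ) :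
    Tendsto (fun n => levyExponent (ν.restrict (bigJumps n)) t) atTop (𝓝 (levyExponent ν t)) :=
  tendsto_setIntegral_bigJumps (integrable_levyExponent hν t) (by simp)

theorem tendsto_levyCgf_restrict_bigJumps (hs : s ∈ levyCgfDomain ν) :
    Tendsto (fun n => levyCgf (ν.restrict (bigJumps n)) s) atTop (𝓝 (levyCgf ν s)) :=
  tendsto_setIntegral_bigJumps hs (by simp)

theorem tendsto_emgf_centredCompoundPoisson (hν : Integrable (fun x : ℝ => x ^ 2) ν)
    (hs : s ∈ levyCgfDomain ν) :
    Tendsto (fun n => emgf id (centredCompoundPoisson (ν.restrict (bigJumps n))) s) atTop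
      (𝓝 (ENNReal.ofReal (Real.exp (levyCgf ν s)))) := by
  have := isFiniteMeasure_restrict_bigJumps hν
  simp_rw [fun n => emgf_centredCompoundPoisson (integrableOn_id_bigJumps hν n)
    (Integrable.restrict hs : s ∈ levyCgfDomain (ν.restrict (bigJumps n)))]
  exact (ENNReal.continuous_ofReal.tendsto _).comp
    ((Real.continuous_exp.tendsto _).comp (tendsto_levyCgf_restrict_bigJumps hs))

theorem exists_one_lt_mul_mem {U : Set ℝ} (hs : s ∈ interior U) : ∃ p > 1, p * s ∈ U := by
  have hcont : ContinuousAt (fun p : ℝ => p * s) 1 := by fun_prop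
  have hmem : ∀ᶠ p in 𝓝 (1 : ℝ), p * s ∈ U :=
    hcont.preimage_mem_nhds (by rwa [one_mul, ← mem_interior_iff_mem_nhds])
  exact (((hmem.filter_mono nhdsWithin_le_nhds).and self_mem_nhdsWithin).exists
    (f := 𝓝[>] 1)).imp fun p hp => hp.symm

theorem emgf_of_charFun_eq_exp_levyExponent [IsProbabilityMeasure ρ]
    (hν : Integrable (fun x : ℝ => x ^ 2) ν)
    (hρ : ∀ t, charFun ρ t = Complex.exp (levyExponent ν t))
    (hs : s ∈ interior (levyCgfDomain ν)) :
    emgf id ρ s = ENNReal.ofReal (Real.exp (levyCgf ν s)) := by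
  have := isFiniteMeasure_restrict_bigJumps hν
  obtain ⟨p, hp, hps⟩ := exists_one_lt_mul_mem hs
  let ρs : ℕ → ProbabilityMeasure ℝ :=
    fun n => ⟨centredCompoundPoisson (ν.restrict (bigJumps n)), inferInstance⟩
  have hweak : Tendsto ρs atTop (𝓝 ⟨ρ, inferInstance⟩) := by
    refine ProbabilityMeasure.tendsto_iff_tendsto_charFun.2 fun t => ?_
    simp only [ρs, ProbabilityMeasure.coe_mk, hρ,
      fun n => charFun_centredCompoundPoisson (integrableOn_id_bigJumps hν n)]
    exact (Complex.continuous_exp.tendsto _).comp (tendsto_levyExponent_restrict_bigJumps hν t)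
  have hpow : ∀ x : ℝ, ENNReal.ofReal (Real.exp (s * x)) ^ p =
      ENNReal.ofReal (Real.exp (p * s * x)) := fun x => by
    rw [ENNReal.ofReal_rpow_of_pos (Real.exp_pos _), ← Real.exp_mul, mul_right_comm, mul_comm p,
      mul_right_comm]
  have hbound : ∀ᶠ n in atTop, ∫⁻ x, ENNReal.ofReal (Real.exp (s * x)) ^ p ∂(ρs n : Measure ℝ) ≤
      ENNReal.ofReal (Real.exp (levyCgf ν (p * s))) + 1 := by
    simp_rw [hpow]
    exact (tendsto_emgf_centredCompoundPoisson hν hps).eventually_le_const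
      (ENNReal.lt_add_right ENNReal.ofReal_ne_top one_ne_zero)
  have hconv := tendsto_lintegral_of_lintegral_rpow_le hweak
    (f := fun x => Real.toNNReal (Real.exp (s * x))) (by fun_prop) hp (by finiteness)
    hbound
  exact tendsto_nhds_unique hconv
    (tendsto_emgf_centredCompoundPoisson hν (interior_subset hs))

end SmallJumpTruncation

section SecondDerivative

variable {f f' f'' : ℝ → ℝ} {I : Set ℝ} {s : ℝ}

theorem mul_mem_of_starConvex (hI : StarConvex ℝ 0 I) (hs : s ∈ I) {r : ℝ}
    (hr : r ∈ Icc (0 : ℝ) 1) : r * s ∈ I :=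
  hI.smul_mem hs hr.1 hr.2

theorem integral_taylor_two (hI : StarConvex ℝ 0 I) (hf : ∀ u ∈ I, HasDerivAt f (f' u) u)
    (hf' : ∀ u ∈ I, HasDerivAt f' (f'' u) u) (hf'' : ContinuousOn f'' I) (hs : s ∈ I) :
    IntegrableOn (fun r => (1 - r) * s ^ 2 * f'' (r * s)) (Ioc 0 1) ∧
      ∫ r in Ioc (0 : ℝ) 1, (1 - r) * s ^ 2 * f'' (r * s) = f s - f 0 - s * f' 0 := by
  have hmem : MapsTo (fun r : ℝ => r * s) (Icc 0 1) I := fun r hr => mul_mem_of_starConvex hI hs hr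
  have hderiv : ∀ r ∈ uIcc (0 : ℝ) 1, HasDerivAt (fun r => f (r * s) + (1 - r) * s * f' (r * s))
      ((1 - r) * s ^ 2 * f'' (r * s)) r := by
    intro r hr
    rw [uIcc_of_le zero_le_one] at hr
    have hlin : HasDerivAt (fun r : ℝ => r * s) s r := hasDerivAt_mul_const s
    have hweight : HasDerivAt (fun r : ℝ => (1 - r) * s) (-1 * s) r :=
      ((hasDerivAt_id r).const_sub 1).mul_const s
    refine (((hf _ (hmem hr)).comp r hlin).add
      (hweight.mul ((hf' _ (hmem hr)).comp r hlin))).congr_deriv ?_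
    simp only [Function.comp_apply]
    ring
  have hint : IntervalIntegrable (fun r => (1 - r) * s ^ 2 * f'' (r * s)) volume 0 1 :=
    (ContinuousOn.mul (by fun_prop) (hf''.comp (by fun_prop) hmem)).intervalIntegrable_of_Icc
      zero_le_one
  refine ⟨(intervalIntegrable_iff_integrableOn_Ioc_of_le zero_le_one).1 hint, ?_⟩
  rw [← intervalIntegral.integral_of_le zero_le_one,
    intervalIntegral.integral_eq_sub_of_hasDerivAt hderiv hint, zero_mul, one_mul]
  ring

theorem taylor_two_nonneg (hI : StarConvex ℝ 0 I) (hf : ∀ u ∈ I, HasDerivAt f (f' u) u)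
    (hf' : ∀ u ∈ I, HasDerivAt f' (f'' u) u) (hf'' : ContinuousOn f'' I)
    (hpos : ∀ u ∈ I, 0 ≤ f'' u) (hs : s ∈ I) : 0 ≤ f s - f 0 - s * f' 0 := by
  rw [← (integral_taylor_two hI hf hf' hf'' hs).2]
  refine setIntegral_nonneg measurableSet_Ioc fun r hr => ?_
  exact mul_nonneg (mul_nonneg (sub_nonneg.2 hr.2) (sq_nonneg s))
    (hpos _ (mul_mem_of_starConvex hI hs (Ioc_subset_Icc_self hr)))

theorem lintegral_taylor_two (hI : StarConvex ℝ 0 I) (hf : ∀ u ∈ I, HasDerivAt f (f' u) u)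
    (hf' : ∀ u ∈ I, HasDerivAt f' (f'' u) u) (hf'' : ContinuousOn f'' I)
    (hpos : ∀ u ∈ I, 0 ≤ f'' u) (hs : s ∈ I) :
    ∫⁻ r in Ioc (0 : ℝ) 1, ENNReal.ofReal ((1 - r) * s ^ 2) * ENNReal.ofReal (f'' (r * s)) =
      ENNReal.ofReal (f s - f 0 - s * f' 0) := by
  obtain ⟨hint, heq⟩ := integral_taylor_two hI hf hf' hf'' hs
  have hweight : ∀ r ∈ Ioc (0 : ℝ) 1, 0 ≤ (1 - r) * s ^ 2 := fun r hr =>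
    mul_nonneg (sub_nonneg.2 hr.2) (sq_nonneg s)
  rw [← heq, ofReal_integral_eq_lintegral_ofReal hint]
  · exact setLIntegral_congr_fun measurableSet_Ioc fun r hr =>
      (ENNReal.ofReal_mul (hweight r hr)).symm
  · exact (ae_restrict_iff' measurableSet_Ioc).2 (ae_of_all _ fun r hr => mul_nonneg (hweight r hr)
      (hpos _ (mul_mem_of_starConvex hI hs (Ioc_subset_Icc_self hr))))

theorem lintegral_taylor_exp (y : ℝ) :
    ∫⁻ r in Ioc (0 : ℝ) 1, ENNReal.ofReal ((1 - r) * y ^ 2) * ENNReal.ofReal (Real.exp (r * y)) =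
      ENNReal.ofReal (Real.exp y - 1 - y) := by
  rw [lintegral_taylor_two (I := univ) (starConvex_univ 0)
    (fun u _ => Real.hasDerivAt_exp u) (fun u _ => Real.hasDerivAt_exp u)
    Real.continuous_exp.continuousOn (fun u _ => Real.exp_nonneg u) (mem_univ y), Real.exp_zero,
    mul_one]

/- By Tonelli, integrating the Taylor formula for `exp` against `ν` gives the Taylor formula for a
function whose second derivative is `u ↦ ∫ x² e^{ux} ν(dx)`. -/
theorem lintegral_exp_sub_one_sub_eq {ν : Measure ℝ} [SFinite ν] (hI : StarConvex ℝ 0 I)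
    (hf : ∀ u ∈ I, HasDerivAt f (f' u) u) (hf' : ∀ u ∈ I, HasDerivAt f' (f'' u) u)
    (hf'' : ContinuousOn f'' I) (hpos : ∀ u ∈ I, 0 ≤ f'' u)
    (hν : ∀ u ∈ I, ∫⁻ x, ENNReal.ofReal (x ^ 2 * Real.exp (u * x)) ∂ν = ENNReal.ofReal (f'' u))
    (hs : s ∈ I) :
    ∫⁻ x, ENNReal.ofReal (Real.exp (s * x) - 1 - s * x) ∂ν =
      ENNReal.ofReal (f s - f 0 - s * f' 0) := by
  calc ∫⁻ x, ENNReal.ofReal (Real.exp (s * x) - 1 - s * x) ∂ν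
      = ∫⁻ x, (∫⁻ r in Ioc (0 : ℝ) 1, ENNReal.ofReal ((1 - r) * (s * x) ^ 2) *
          ENNReal.ofReal (Real.exp (r * (s * x)))) ∂ν := by simp_rw [lintegral_taylor_exp]
    _ = ∫⁻ r in Ioc (0 : ℝ) 1, ∫⁻ x, ENNReal.ofReal ((1 - r) * (s * x) ^ 2) *
          ENNReal.ofReal (Real.exp (r * (s * x))) ∂ν :=
        lintegral_lintegral_swap (by unfold Function.uncurry; fun_prop)
    _ = ∫⁻ r in Ioc (0 : ℝ) 1, ENNReal.ofReal ((1 - r) * s ^ 2) *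
          ENNReal.ofReal (f'' (r * s)) := by
        refine setLIntegral_congr_fun measurableSet_Ioc fun r hr => ?_
        have hweight : 0 ≤ (1 - r) * s ^ 2 := mul_nonneg (sub_nonneg.2 hr.2) (sq_nonneg s)
        rw [← hν _ (mul_mem_of_starConvex hI hs (Ioc_subset_Icc_self hr)),
          ← lintegral_const_mul _ (by fun_prop)]
        refine lintegral_congr fun x => ?_
        rw [← ENNReal.ofReal_mul' (Real.exp_nonneg _), ← ENNReal.ofReal_mul hweight]
        ring_nf
    _ = ENNReal.ofReal (f s - f 0 - s * f' 0) := lintegral_taylor_two hI hf hf' hf'' hpos hs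

theorem levyCgf_of_lintegral_sq_mul_exp {ν : Measure ℝ} [SFinite ν] (hI : StarConvex ℝ 0 I)
    (hf : ∀ u ∈ I, HasDerivAt f (f' u) u) (hf' : ∀ u ∈ I, HasDerivAt f' (f'' u) u)
    (hf'' : ContinuousOn f'' I) (hpos : ∀ u ∈ I, 0 ≤ f'' u)
    (hν : ∀ u ∈ I, ∫⁻ x, ENNReal.ofReal (x ^ 2 * Real.exp (u * x)) ∂ν = ENNReal.ofReal (f'' u))
    (hs : s ∈ I) :
    s ∈ levyCgfDomain ν ∧ levyCgf ν s = f s - f 0 - s * f' 0 := by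
  have heq := lintegral_exp_sub_one_sub_eq hI hf hf' hf'' hpos hν hs
  have hnonneg : 0 ≤ᵐ[ν] fun x => Real.exp (s * x) - 1 - s * x :=
    ae_of_all _ fun x => by
      simpa only [Pi.zero_apply, sub_sub, sub_nonneg, add_comm] using Real.add_one_le_exp (s * x)
  have hmeas : AEStronglyMeasurable (fun x : ℝ => Real.exp (s * x) - 1 - s * x) ν := by fun_prop
  refine ⟨(lintegral_ofReal_ne_top_iff_integrable hmeas hnonneg).1
    (heq ▸ ENNReal.ofReal_ne_top), ?_⟩
  rw [levyCgf, integral_eq_lintegral_of_nonneg_ae hnonneg hmeas, heq,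
    ENNReal.toReal_ofReal (taylor_two_nonneg hI hf hf' hf'' hpos hs)]

end SecondDerivative

section CumulantGeneratingFunction

variable {α lam lp lm s u : ℝ}

/-- The contribution of the positive jumps to `PhiH`, before normalization: the solution on
`(-∞, lam)` of `f'' = (lam - ·) ^ (α - 2)`, `f 0 = f' 0 = 0`. -/
noncomputable def halfCgf (α lam s : ℝ) : ℝ :=
  if α = 1 then (lam - s) * Real.log ((lam - s) / lam) + s
  else ((lam - s) ^ α - lam ^ α) / (α * (α - 1)) + lam ^ (α - 1) * s / (α - 1)

/-- The derivative of `halfCgf α lam` on `(-∞, lam)`. -/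
noncomputable def halfCgfDeriv (α lam s : ℝ) : ℝ :=
  if α = 1 then -Real.log ((lam - s) / lam)
  else (lam ^ (α - 1) - (lam - s) ^ (α - 1)) / (α - 1)

theorem halfCgf_of_eq_one (h : α = 1) :
    halfCgf α lam = fun s => (lam - s) * Real.log ((lam - s) / lam) + s :=
  funext fun _ => if_pos h

theorem halfCgf_of_ne_one (h : α ≠ 1) :
    halfCgf α lam =
      fun s => ((lam - s) ^ α - lam ^ α) / (α * (α - 1)) + lam ^ (α - 1) * s / (α - 1) :=
  funext fun _ => if_neg h

theorem halfCgfDeriv_of_eq_one (h : α = 1) :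
    halfCgfDeriv α lam = fun s => -Real.log ((lam - s) / lam) :=
  funext fun _ => if_pos h

theorem halfCgfDeriv_of_ne_one (h : α ≠ 1) :
    halfCgfDeriv α lam = fun s => (lam ^ (α - 1) - (lam - s) ^ (α - 1)) / (α - 1) :=
  funext fun _ => if_neg h

theorem halfCgf_zero (α : ℝ) (hlam : lam ≠ 0) : halfCgf α lam 0 = 0 := by
  simp [halfCgf, hlam]

theorem halfCgfDeriv_zero (α : ℝ) (hlam : lam ≠ 0) : halfCgfDeriv α lam 0 = 0 := by
  simp [halfCgfDeriv, hlam]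

theorem hasDerivAt_halfCgf (hα : α ≠ 0) (hlam : lam ≠ 0) (hs : s < lam) :
    HasDerivAt (halfCgf α lam) (halfCgfDeriv α lam s) s := by
  have hlin : HasDerivAt (fun s : ℝ => lam - s) (-1) s := (hasDerivAt_id s).const_sub lam
  have hne : lam - s ≠ 0 := (sub_pos.2 hs).ne'
  by_cases h1 : α = 1
  · rw [halfCgf_of_eq_one h1, halfCgfDeriv_of_eq_one h1]
    refine ((hlin.mul ((hlin.div_const lam).log (div_ne_zero hne hlam))).add
      (hasDerivAt_id s)).congr_deriv ?_
    field_simp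
    ring
  · have h1' : α - 1 ≠ 0 := sub_ne_zero.2 h1
    rw [halfCgf_of_ne_one h1, halfCgfDeriv_of_ne_one h1]
    refine ((((hlin.rpow_const (p := α) (Or.inl hne)).sub_const _).div_const _).add
      (((hasDerivAt_id s).const_mul _).div_const _)).congr_deriv ?_
    field_simp
    ring

theorem hasDerivAt_halfCgfDeriv (hlam : lam ≠ 0) (hs : s < lam) :
    HasDerivAt (halfCgfDeriv α lam) ((lam - s) ^ (α - 2)) s := by
  have hlin : HasDerivAt (fun s : ℝ => lam - s) (-1) s := (hasDerivAt_id s).const_sub lam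
  have hne : lam - s ≠ 0 := (sub_pos.2 hs).ne'
  by_cases h1 : α = 1
  · rw [halfCgfDeriv_of_eq_one h1, h1, show (1 : ℝ) - 2 = -1 by norm_num, Real.rpow_neg_one]
    refine ((hlin.div_const lam).log (div_ne_zero hne hlam)).neg.congr_deriv ?_
    field_simp
  · have h1' : α - 1 ≠ 0 := sub_ne_zero.2 h1
    rw [halfCgfDeriv_of_ne_one h1, show α - 2 = α - 1 - 1 by ring]
    refine (((hlin.rpow_const (p := α - 1) (Or.inl hne)).const_sub _).div_const _).congr_deriv ?_
    field_simp

theorem continuous_halfCgf (hα : 0 ≤ α) (hlam : lam ≠ 0) : Continuous (halfCgf α lam) := by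
  by_cases h1 : α = 1
  · have heq : halfCgf α lam =
        fun s => lam * ((lam - s) / lam * Real.log ((lam - s) / lam)) + s := by
      rw [halfCgf_of_eq_one h1]
      funext s
      rw [← mul_assoc, mul_div_cancel₀ _ hlam]
    have hlog : Continuous fun s : ℝ => (lam - s) / lam * Real.log ((lam - s) / lam) :=
      Real.continuous_mul_log.comp (by fun_prop : Continuous fun s : ℝ => (lam - s) / lam)
    rw [heq]
    exact (hlog.const_mul lam).add continuous_id
  · have hpow : Continuous fun s : ℝ => (lam - s) ^ α :=
      (continuous_const.sub continuous_id).rpow_const fun _ => Or.inr hα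
    rw [halfCgf_of_ne_one h1]
    exact ((hpow.sub continuous_const).div_const _).add (by fun_prop)

theorem PhiH_eq_halfCgf (α lp lm u : ℝ) :
    PhiH α lp lm u = (halfCgf α lp u + halfCgf α lm (-u)) / (lp ^ (α - 2) + lm ^ (α - 2)) := by
  by_cases h1 : α = 1
  · simp only [PhiH, halfCgf, h1, if_true]
    rw [show (1 : ℝ) - 2 = -1 by norm_num, Real.rpow_neg_one, Real.rpow_neg_one, sub_neg_eq_add]
    ring
  · simp only [PhiH, halfCgf, h1, if_false, sub_neg_eq_add]
    generalize lp ^ (α - 2) + lm ^ (α - 2) = S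
    rw [add_div, add_div, add_div, div_div, div_div, div_div, div_div]
    ring

theorem PhiH_neg (α lp lm u : ℝ) : PhiH α lp lm (-u) = PhiH α lm lp u := by
  rw [PhiH_eq_halfCgf, PhiH_eq_halfCgf, neg_neg, add_comm, add_comm (lp ^ _)]

theorem PhiH_zero (α : ℝ) (hlp : lp ≠ 0) (hlm : lm ≠ 0) : PhiH α lp lm 0 = 0 := by
  rw [PhiH_eq_halfCgf, neg_zero, halfCgf_zero α hlp, halfCgf_zero α hlm, add_zero, zero_div]

theorem continuous_PhiH (hα : 0 ≤ α) (hlp : lp ≠ 0) (hlm : lm ≠ 0) :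
    Continuous (PhiH α lp lm) := by
  rw [show PhiH α lp lm = _ from funext (PhiH_eq_halfCgf α lp lm)]
  exact ((continuous_halfCgf hα hlp).add
    ((continuous_halfCgf hα hlm).comp continuous_neg)).div_const _

/-- The derivative of `PhiH α lp lm` on `(-lm, lp)`. -/
noncomputable def PhiHDeriv (α lp lm u : ℝ) : ℝ :=
  (halfCgfDeriv α lp u - halfCgfDeriv α lm (-u)) / (lp ^ (α - 2) + lm ^ (α - 2))

/-- The second derivative of `PhiH α lp lm` on `(-lm, lp)`. -/
noncomputable def PhiHDeriv2 (α lp lm u : ℝ) : ℝ :=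
  ((lp - u) ^ (α - 2) + (lm + u) ^ (α - 2)) / (lp ^ (α - 2) + lm ^ (α - 2))

theorem PhiHDeriv_zero (α : ℝ) (hlp : lp ≠ 0) (hlm : lm ≠ 0) : PhiHDeriv α lp lm 0 = 0 := by
  rw [PhiHDeriv, neg_zero, halfCgfDeriv_zero α hlp, halfCgfDeriv_zero α hlm, sub_zero, zero_div]

theorem hasDerivAt_PhiH (hα : α ≠ 0) (hlp : lp ≠ 0) (hlm : lm ≠ 0) (hu : u ∈ Ioo (-lm) lp) :
    HasDerivAt (PhiH α lp lm) (PhiHDeriv α lp lm u) u := by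
  have hright := hasDerivAt_halfCgf hα hlp hu.2
  have hleft := (hasDerivAt_halfCgf hα hlm (neg_lt.1 hu.1)).comp u (hasDerivAt_neg u)
  rw [show PhiH α lp lm = _ from funext (PhiH_eq_halfCgf α lp lm)]
  refine ((hright.add hleft).div_const _).congr_deriv ?_
  rw [PhiHDeriv, mul_neg_one, ← sub_eq_add_neg]

theorem hasDerivAt_PhiHDeriv (hlp : lp ≠ 0) (hlm : lm ≠ 0) (hu : u ∈ Ioo (-lm) lp) :
    HasDerivAt (PhiHDeriv α lp lm) (PhiHDeriv2 α lp lm u) u := by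
  have hright := hasDerivAt_halfCgfDeriv (α := α) hlp hu.2
  have hleft := (hasDerivAt_halfCgfDeriv (α := α) hlm (neg_lt.1 hu.1)).comp u (hasDerivAt_neg u)
  refine ((hright.sub hleft).div_const _).congr_deriv ?_
  rw [PhiHDeriv2, mul_neg_one, sub_neg_eq_add, sub_neg_eq_add]

theorem continuousOn_PhiHDeriv2 : ContinuousOn (PhiHDeriv2 α lp lm) (Ioo (-lm) lp) := by
  refine (ContinuousOn.add ?_ ?_).div_const _
  · exact ContinuousOn.rpow_const (by fun_prop) fun u hu => Or.inl (sub_pos.2 hu.2).ne'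
  · exact ContinuousOn.rpow_const (by fun_prop) fun u hu =>
      Or.inl (neg_lt_iff_pos_add'.1 hu.1).ne'

theorem PhiHDeriv2_nonneg (hlp : 0 ≤ lp) (hlm : 0 ≤ lm) (hu : u ∈ Icc (-lm) lp) :
    0 ≤ PhiHDeriv2 α lp lm u := by
  have hright : 0 ≤ lp - u := sub_nonneg.2 hu.2
  have hleft : 0 ≤ lm + u := neg_le_iff_add_nonneg'.1 hu.1
  unfold PhiHDeriv2
  positivity

theorem convexOn_PhiH (hα : 0 < α) (hlp : 0 < lp) (hlm : 0 < lm) :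
    ConvexOn ℝ (Icc (-lm) lp) (PhiH α lp lm) := by
  refine convexOn_of_hasDerivWithinAt2_nonneg (f' := PhiHDeriv α lp lm)
    (f'' := PhiHDeriv2 α lp lm) (convex_Icc _ _)
    (continuous_PhiH hα.le hlp.ne' hlm.ne').continuousOn ?_ ?_ ?_ <;>
    rw [interior_Icc] <;> intro u hu
  · exact (hasDerivAt_PhiH hα.ne' hlp.ne' hlm.ne' hu).hasDerivWithinAt
  · exact (hasDerivAt_PhiHDeriv hlp.ne' hlm.ne' hu).hasDerivWithinAt
  · exact PhiHDeriv2_nonneg hlp.le hlm.le (Ioo_subset_Icc_self hu)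

theorem tendsto_PhiHDeriv2_nhdsLT (hα : α < 2) (hlp : 0 < lp) (hlm : 0 < lm) :
    Tendsto (PhiHDeriv2 α lp lm) (𝓝[<] lp) atTop := by
  have hsub : Tendsto (fun u : ℝ => lp - u) (𝓝[<] lp) (𝓝[>] 0) := by
    refine tendsto_nhdsWithin_iff.2
      ⟨?_, eventually_mem_nhdsWithin.mono fun u hu => mem_Ioi.2 (sub_pos.2 hu)⟩
    exact (Continuous.tendsto' (by fun_prop) lp 0 (sub_self lp)).mono_left nhdsWithin_le_nhds
  have hpow : Tendsto (fun u : ℝ => (lp - u) ^ (α - 2)) (𝓝[<] lp) atTop :=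
    (tendsto_rpow_neg_nhdsGT_zero (sub_neg.2 hα)).comp hsub
  refine Tendsto.atTop_div_const (by positivity) (tendsto_atTop_mono' _ ?_ hpow)
  filter_upwards [Ioo_mem_nhdsLT (neg_lt_zero.2 hlm |>.trans hlp)] with u hu
  exact le_add_of_nonneg_right (Real.rpow_nonneg (neg_lt_iff_pos_add'.1 hu.1).le _)

end CumulantGeneratingFunction

section LevyMeasure

theorem lintegral_rpow_mul_exp_neg_mul_Ioi {a r : ℝ} (ha : 0 < a) (hr : 0 < r) :
    ∫⁻ x in Ioi (0 : ℝ), ENNReal.ofReal (x ^ (a - 1) * Real.exp (-(r * x))) =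
      ENNReal.ofReal (Real.Gamma a * r ^ (-a)) := by
  have hint : IntegrableOn (fun x : ℝ => x ^ (a - 1) * Real.exp (-(r * x))) (Ioi 0) := by
    simpa only [Real.rpow_one, neg_mul] using
      integrableOn_rpow_mul_exp_neg_mul_rpow (by linarith : -1 < a - 1) one_pos hr
  rw [← ofReal_integral_eq_lintegral_ofReal hint, Real.integral_rpow_mul_exp_neg_mul_Ioi ha hr,
    mul_comm, Real.rpow_neg hr.le, one_div, Real.inv_rpow hr.le]
  exact (ae_restrict_iff' measurableSet_Ioi).2 (ae_of_all _ fun x hx =>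
    mul_nonneg (Real.rpow_nonneg (le_of_lt hx) _) (Real.exp_nonneg _))

theorem lintegral_eq_lintegral_Ioi_add_neg (f : ℝ → ℝ≥0∞) :
    ∫⁻ x, f x = (∫⁻ x in Ioi 0, f x) + ∫⁻ x in Ioi 0, f (-x) := by
  have hneg : ∫⁻ x in Ioi 0, f (-x) = ∫⁻ x in Iio 0, f x := by
    simpa using (Measure.measurePreserving_neg (volume : Measure ℝ)).setLIntegral_comp_preimage_emb
      (MeasurableEquiv.neg ℝ).measurableEmbedding f (Iio 0)
  rw [hneg, setLIntegral_congr Iio_ae_eq_Iic, ← compl_Ioi,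
    lintegral_add_compl _ measurableSet_Ioi]

variable {α lp lm : ℝ}

theorem stdScale_pos (hα : α < 2) (hlp : 0 < lp) (hlm : 0 < lm) : 0 < stdScale α lp lm :=
  one_div_pos.2 (mul_pos (Real.Gamma_pos_of_pos (sub_pos.2 hα)) (by positivity))

theorem ctsLevyDensity_nonneg {cp cm : ℝ} (hcp : 0 ≤ cp) (hcm : 0 ≤ cm) (x : ℝ) :
    0 ≤ ctsLevyDensity α lp lm cp cm x := by
  unfold ctsLevyDensity
  split_ifs <;> positivity

@[fun_prop]
theorem measurable_ctsLevyDensity (α lp lm cp cm : ℝ) :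
    Measurable (ctsLevyDensity α lp lm cp cm) :=
  Measurable.ite measurableSet_Ioi (by fun_prop)
    (Measurable.ite measurableSet_Iio (by fun_prop) (by fun_prop))

theorem ctsLevyDensity_neg (α lp lm cp cm x : ℝ) :
    ctsLevyDensity α lp lm cp cm (-x) = ctsLevyDensity α lm lp cm cp x := by
  unfold ctsLevyDensity
  rcases lt_trichotomy x 0 with hx | rfl | hx
  · simp [hx, hx.not_gt, abs_of_neg]
  · simp
  · simp [hx, hx.not_gt, abs_of_pos]

theorem lintegral_Ioi_mul_sq_mul_exp_mul_ctsLevyDensity {cp cm s : ℝ} (hα : α < 2) (hcp : 0 ≤ cp)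
    (hs : s < lp) :
    ∫⁻ x in Ioi (0 : ℝ), ENNReal.ofReal (ctsLevyDensity α lp lm cp cm x) *
        ENNReal.ofReal (x ^ 2 * Real.exp (s * x)) =
      ENNReal.ofReal (cp * Real.Gamma (2 - α) * (lp - s) ^ (α - 2)) := by
  have hdens : ∀ x ∈ Ioi (0 : ℝ), ENNReal.ofReal (ctsLevyDensity α lp lm cp cm x) *
        ENNReal.ofReal (x ^ 2 * Real.exp (s * x)) =
      ENNReal.ofReal cp * ENNReal.ofReal (x ^ (2 - α - 1) * Real.exp (-((lp - s) * x))) := by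
    intro x hx
    have hpow : x ^ (2 - α - 1) = x ^ 2 * x ^ (-1 - α) := by
      rw [← Real.rpow_two, ← Real.rpow_add hx]
      ring_nf
    have hexp : Real.exp (-((lp - s) * x)) = Real.exp (s * x) * Real.exp (-lp * x) := by
      rw [← Real.exp_add]
      ring_nf
    rw [← ENNReal.ofReal_mul' (by positivity), ← ENNReal.ofReal_mul hcp, ctsLevyDensity,
      if_pos (mem_Ioi.1 hx), hpow, hexp]
    ring_nf
  rw [setLIntegral_congr_fun measurableSet_Ioi hdens, lintegral_const_mul _ (by fun_prop),
    lintegral_rpow_mul_exp_neg_mul_Ioi (sub_pos.2 hα) (sub_pos.2 hs), ← ENNReal.ofReal_mul hcp,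
    neg_sub, mul_assoc]

/-- The Lévy measure of `stdCTS(α, lp, lm)`. -/
noncomputable def levyMeasure (α lp lm : ℝ) : Measure ℝ :=
  volume.withDensity fun x =>
    ENNReal.ofReal (ctsLevyDensity α lp lm (stdScale α lp lm) (stdScale α lp lm) x)

instance sFinite_levyMeasure (α lp lm : ℝ) : SFinite (levyMeasure α lp lm) := by
  unfold levyMeasure
  infer_instance

theorem lintegral_sq_mul_exp_levyMeasure (hα : α < 2) (hlp : 0 < lp) (hlm : 0 < lm) {s : ℝ}
    (hs : s ∈ Ioo (-lm) lp) :
    ∫⁻ x, ENNReal.ofReal (x ^ 2 * Real.exp (s * x)) ∂(levyMeasure α lp lm) =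
      ENNReal.ofReal (PhiHDeriv2 α lp lm s) := by
  have hc := (stdScale_pos hα hlp hlm).le
  have hΓ : 0 < Real.Gamma (2 - α) := Real.Gamma_pos_of_pos (sub_pos.2 hα)
  have hright : 0 < lp - s := sub_pos.2 hs.2
  have hleft : 0 < lm - -s := sub_pos.2 (neg_lt.1 hs.1)
  rw [levyMeasure, lintegral_withDensity_eq_lintegral_mul _ (by fun_prop) (by fun_prop),
    lintegral_eq_lintegral_Ioi_add_neg]
  simp only [Pi.mul_apply, ctsLevyDensity_neg, neg_sq, mul_neg, ← neg_mul]
  rw [lintegral_Ioi_mul_sq_mul_exp_mul_ctsLevyDensity hα hc hs.2,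
    lintegral_Ioi_mul_sq_mul_exp_mul_ctsLevyDensity hα hc (neg_lt.1 hs.1),
    ← ENNReal.ofReal_add (by positivity) (by positivity), PhiHDeriv2, stdScale, sub_neg_eq_add]
  congr 1
  field_simp

theorem integrable_sq_levyMeasure (hα : α < 2) (hlp : 0 < lp) (hlm : 0 < lm) :
    Integrable (fun x : ℝ => x ^ 2) (levyMeasure α lp lm) := by
  refine (lintegral_ofReal_ne_top_iff_integrable (by fun_prop)
    (ae_of_all _ fun x => sq_nonneg x)).1 ?_
  have h := lintegral_sq_mul_exp_levyMeasure hα hlp hlm (s := 0) ⟨neg_lt_zero.2 hlm, hlp⟩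
  simp only [zero_mul, Real.exp_zero, mul_one] at h
  exact h ▸ ENNReal.ofReal_ne_top

theorem levyCgf_levyMeasure (hα0 : α ≠ 0) (hα2 : α < 2) (hlp : 0 < lp) (hlm : 0 < lm) {s : ℝ}
    (hs : s ∈ Ioo (-lm) lp) :
    s ∈ levyCgfDomain (levyMeasure α lp lm) ∧ levyCgf (levyMeasure α lp lm) s = PhiH α lp lm s := by
  have h := levyCgf_of_lintegral_sq_mul_exp
    ((convex_Ioo (-lm) lp).starConvex ⟨neg_lt_zero.2 hlm, hlp⟩)
    (fun u hu => hasDerivAt_PhiH hα0 hlp.ne' hlm.ne' hu)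
    (fun u hu => hasDerivAt_PhiHDeriv (α := α) hlp.ne' hlm.ne' hu) continuousOn_PhiHDeriv2
    (fun u hu => PhiHDeriv2_nonneg hlp.le hlm.le (Ioo_subset_Icc_self hu))
    (fun u hu => lintegral_sq_mul_exp_levyMeasure hα2 hlp hlm hu) hs
  rwa [PhiH_zero α hlp.ne' hlm.ne', PhiHDeriv_zero α hlp.ne' hlm.ne', mul_zero, sub_zero,
    sub_zero] at h

theorem levyExponent_levyMeasure (hα : α < 2) (hlp : 0 < lp) (hlm : 0 < lm) (t : ℝ) :
    levyExponent (levyMeasure α lp lm) t =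
      ctsCharExponent α lp lm (stdScale α lp lm) (stdScale α lp lm) 0 t := by
  have hc := (stdScale_pos hα hlp hlm).le
  rw [levyExponent, levyMeasure, integral_withDensity_eq_integral_toReal_smul (by fun_prop)
    (ae_of_all _ fun x => ENNReal.ofReal_lt_top), ctsCharExponent, Complex.ofReal_zero, mul_zero,
    zero_add]
  refine integral_congr_ae (ae_of_all _ fun x => ?_)
  simp only [ENNReal.toReal_ofReal (ctsLevyDensity_nonneg hc hc x), Complex.real_smul, mul_comm]

end LevyMeasure

section Scaling

variable {α lp lm w : ℝ}

theorem stdScale_mul (hlp : 0 ≤ lp) (hlm : 0 ≤ lm) (hw : 0 < w) :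
    stdScale α (lp * w) (lm * w) = w ^ (2 - α) * stdScale α lp lm := by
  rw [stdScale, stdScale, Real.mul_rpow hlp hw.le, Real.mul_rpow hlm hw.le, ← add_mul,
    ← mul_assoc, ← neg_sub α 2, Real.rpow_neg hw.le, one_div, one_div, mul_inv_rev]

theorem ctsLevyDensity_stdScale_mul (hlp : 0 ≤ lp) (hlm : 0 ≤ lm) (hw : 0 < w) (x : ℝ) :
    ctsLevyDensity α (lp * w) (lm * w) (stdScale α (lp * w) (lm * w))
        (stdScale α (lp * w) (lm * w)) x =
      w ^ 3 * ctsLevyDensity α lp lm (stdScale α lp lm) (stdScale α lp lm) (w * x) := by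
  have hpow : w ^ (2 - α) = w ^ 3 * w ^ (-1 - α) := by
    rw [← Real.rpow_natCast, ← Real.rpow_add hw, Nat.cast_ofNat]
    ring_nf
  have hpos : 0 < w * x ↔ 0 < x := mul_pos_iff_of_pos_left hw
  have hneg : w * x < 0 ↔ x < 0 := smul_neg_iff_of_pos_left hw
  simp only [stdScale_mul hlp hlm hw, hpow, ctsLevyDensity, hpos, hneg, abs_mul, abs_of_pos hw]
  split_ifs with hx
  · rw [Real.mul_rpow hw.le hx.le]
    ring_nf
  · rw [Real.mul_rpow hw.le (abs_nonneg x)]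
    ring_nf
  · rw [mul_zero]

/- The tempering parameters in the conditional law of `X` are such that the Lévy measure of `√V X`
depends on `V` only through its total mass. -/
theorem levyExponent_levyMeasure_mul (hα : α < 2) (hlp : 0 < lp) (hlm : 0 < lm) (hw : 0 < w)
    (t : ℝ) :
    levyExponent (levyMeasure α (lp * w) (lm * w)) (w * t) =
      w ^ 2 * levyExponent (levyMeasure α lp lm) t := by
  rw [levyExponent_levyMeasure hα (mul_pos hlp hw) (mul_pos hlm hw),
    levyExponent_levyMeasure hα hlp hlm]
  simp only [ctsCharExponent, Complex.ofReal_zero, mul_zero, zero_add,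
    ctsLevyDensity_stdScale_mul hlp.le hlm.le hw]
  have hsubst := Measure.integral_comp_mul_left (fun y : ℝ =>
    (Complex.exp (Complex.I * t * y) - 1 - Complex.I * t * y) *
      (ctsLevyDensity α lp lm (stdScale α lp lm) (stdScale α lp lm) y : ℂ)) w
  have hjac : w ^ 2 = w ^ 3 * |w⁻¹| := by
    rw [abs_of_pos (inv_pos.2 hw), pow_succ w 2, mul_inv_cancel_right₀ hw.ne']
  rw [← Complex.ofReal_pow, hjac, Complex.ofReal_mul (w ^ 3), mul_assoc,
    ← Complex.real_smul (x := |w⁻¹|), ← hsubst, ← integral_const_mul]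
  refine integral_congr_ae (ae_of_all _ fun x => ?_)
  push_cast
  ring_nf

end Scaling

section MomentStrip

variable {Ω : Type*} [MeasurableSpace Ω] {P : Measure Ω} {X : Ω → ℝ} {a c s : ℝ} {f f' f'' : ℝ → ℝ}

theorem emgf_eq_of_mem_closure [IsFiniteMeasure P] (hX : AEMeasurable X P) {I : Set ℝ}
    (hI : Convex ℝ I) (h0 : 0 ∈ interior I) (hs : s ∈ closure I) (hf : ContinuousAt f s)
    (h : ∀ u ∈ interior I, emgf X P u = ENNReal.ofReal (Real.exp (f u))) :
    emgf X P s = ENNReal.ofReal (Real.exp (f s)) := by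
  have hlim : Tendsto (fun r => ENNReal.ofReal (Real.exp (f (r * s)))) (𝓝[<] 1)
      (𝓝 (ENNReal.ofReal (Real.exp (f s)))) := by
    have hr : Tendsto (fun r : ℝ => r * s) (𝓝[<] 1) (𝓝 s) :=
      ((continuous_mul_const s).tendsto' 1 s (one_mul s)).mono_left nhdsWithin_le_nhds
    exact ENNReal.tendsto_ofReal ((hf.tendsto.comp hr).rexp)
  refine tendsto_nhds_unique (tendsto_emgf_mul_left hX) (hlim.congr' ?_)
  filter_upwards [Ioo_mem_nhdsLT (zero_lt_one (α := ℝ))] with r hr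
  have hrs := hI.combo_interior_closure_mem_interior h0 hs (sub_pos.2 hr.2) hr.1.le
    (sub_add_cancel 1 r)
  rw [smul_zero, zero_add, smul_eq_mul] at hrs
  exact (h _ hrs).symm

/- Past `c` the cumulant generating function would be analytic at `c`, with bounded second
derivative. -/
theorem notMem_integrableExpSet_of_tendsto_atTop (hac : a < c)
    (hmem : Ioo a c ⊆ integrableExpSet X P) (hcgf : EqOn (cgf X P) f (Ioo a c))
    (hf : ∀ u ∈ Ioo a c, HasDerivAt f (f' u) u) (hf' : ∀ u ∈ Ioo a c, HasDerivAt f' (f'' u) u)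
    (hf'' : Tendsto f'' (𝓝[<] c) atTop) (hcs : c < s) : s ∉ integrableExpSet X P := by
  intro hs
  obtain ⟨u, hau, huc⟩ := exists_between hac
  have hint : c ∈ interior (integrableExpSet X P) :=
    interior_maximal (Ioo_subset_Icc_self.trans
      (convex_integrableExpSet.ordConnected.out (hmem ⟨hau, huc⟩) hs)) isOpen_Ioo ⟨huc, hcs⟩
  have hderiv : EqOn (deriv (cgf X P)) f' (Ioo a c) := fun u hu =>
    ((hf u hu).congr_of_eventuallyEq (hcgf.eventuallyEq_of_mem (isOpen_Ioo.mem_nhds hu))).deriv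
  have hderiv2 : EqOn (deriv (deriv (cgf X P))) f'' (Ioo a c) := fun u hu =>
    ((hf' u hu).congr_of_eventuallyEq (hderiv.eventuallyEq_of_mem (isOpen_Ioo.mem_nhds hu))).deriv
  have hbdd : Tendsto (deriv (deriv (cgf X P))) (𝓝[<] c) (𝓝 (deriv (deriv (cgf X P)) c)) :=
    (analyticAt_cgf hint).deriv.deriv.continuousAt.tendsto.mono_left nhdsWithin_le_nhds
  exact not_tendsto_nhds_of_tendsto_atTop
    (hf''.congr' (hderiv2.symm.eventuallyEq_of_mem (Ioo_mem_nhdsLT hac))) _ hbdd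

end MomentStrip

section StdCTS

variable {Ω : Type*} [MeasurableSpace Ω] {P : Measure Ω} {X : Ω → ℝ} {α lp lm v w s : ℝ}
  {ρ : Measure ℝ}

theorem emgf_eq_top_of_lt (hα0 : α ≠ 0) (hα2 : α < 2) (hlp : 0 < lp) (hlm : 0 < lm) (hv : 0 < v)
    (hX : AEMeasurable X P)
    (h : ∀ u ∈ Ioo (-lm) lp, emgf X P u = ENNReal.ofReal (Real.exp (v * PhiH α lp lm u)))
    (hs : lp < s) : emgf X P s = ⊤ := by
  have hmem : Ioo (-lm) lp ⊆ integrableExpSet X P := fun u hu =>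
    (emgf_lt_top_iff hX).1 (h u hu ▸ ENNReal.ofReal_lt_top)
  have hcgf : EqOn (cgf X P) (fun u => v * PhiH α lp lm u) (Ioo (-lm) lp) := fun u hu => by
    rw [cgf, mgf_eq_toReal_emgf hX, h u hu, ENNReal.toReal_ofReal (Real.exp_nonneg _),
      Real.log_exp]
  have hnot := notMem_integrableExpSet_of_tendsto_atTop ((neg_lt_zero.2 hlm).trans hlp) hmem hcgf
    (fun u hu => (hasDerivAt_PhiH hα0 hlp.ne' hlm.ne' hu).const_mul v)
    (fun u hu => (hasDerivAt_PhiHDeriv (α := α) hlp.ne' hlm.ne' hu).const_mul v)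
    ((tendsto_PhiHDeriv2_nhdsLT hα2 hlp hlm).const_mul_atTop hv) hs
  rwa [← emgf_lt_top_iff hX, not_lt_top_iff] at hnot

theorem emgf_eq_top_of_notMem_Icc (hα0 : α ≠ 0) (hα2 : α < 2) (hlp : 0 < lp) (hlm : 0 < lm)
    (hv : 0 < v) (hX : AEMeasurable X P)
    (h : ∀ u ∈ Ioo (-lm) lp, emgf X P u = ENNReal.ofReal (Real.exp (v * PhiH α lp lm u)))
    (hs : s ∉ Icc (-lm) lp) : emgf X P s = ⊤ := by
  rcases lt_or_ge lp s with hright | hle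
  · exact emgf_eq_top_of_lt hα0 hα2 hlp hlm hv hX h hright
  · have hleft : lm < -s := lt_neg.2 (not_le.1 fun hge => hs ⟨hge, hle⟩)
    have hneg : ∀ u ∈ Ioo (-lp) lm,
        emgf (-X) P u = ENNReal.ofReal (Real.exp (v * PhiH α lm lp u)) := fun u hu => by
      rw [emgf_neg, h _ ⟨neg_lt_neg hu.2, neg_lt.1 hu.1⟩, PhiH_neg]
    rw [← neg_neg s, ← emgf_neg]
    exact emgf_eq_top_of_lt hα0 hα2 hlm hlp hv hX.neg hneg hleft

theorem charFun_map_mul_of_isStdCTS (hα : α < 2) (hlp : 0 < lp) (hlm : 0 < lm) (hw : 0 < w)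
    (hρ : IsStdCTS α (lp * w) (lm * w) ρ) (t : ℝ) :
    charFun (ρ.map (w * ·)) t =
      Complex.exp (levyExponent ((w ^ 2).toNNReal • levyMeasure α lp lm) t) := by
  rw [charFun_map_mul, hρ.2, ← levyExponent_levyMeasure hα (mul_pos hlp hw) (mul_pos hlm hw),
    levyExponent_levyMeasure_mul hα hlp hlm hw, levyExponent_smul,
    Real.coe_toNNReal _ (sq_nonneg w), Complex.ofReal_pow]

theorem emgf_mul_of_isStdCTS_of_mem_Ioo (hα0 : α ≠ 0) (hα2 : α < 2) (hlp : 0 < lp) (hlm : 0 < lm)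
    (hw : 0 < w) (hρ : IsStdCTS α (lp * w) (lm * w) ρ) (hs : s ∈ Ioo (-lm) lp) :
    emgf (fun x => w * x) ρ s = ENNReal.ofReal (Real.exp (w ^ 2 * PhiH α lp lm s)) := by
  have := hρ.1
  have : IsProbabilityMeasure (ρ.map (w * ·)) := Measure.isProbabilityMeasure_map (by fun_prop)
  have hdom : Ioo (-lm) lp ⊆ levyCgfDomain ((w ^ 2).toNNReal • levyMeasure α lp lm) := fun u hu =>
    levyCgfDomain_subset_smul _ (levyCgf_levyMeasure hα0 hα2 hlp hlm hu).1
  rw [← emgf_id_map (X := fun x => w * x) (by fun_prop), emgf_of_charFun_eq_exp_levyExponent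
    (integrable_sq_levyMeasure hα2 hlp hlm).smul_measure_nnreal
    (charFun_map_mul_of_isStdCTS hα2 hlp hlm hw hρ) (interior_maximal hdom isOpen_Ioo hs),
    levyCgf_smul, (levyCgf_levyMeasure hα0 hα2 hlp hlm hs).2, Real.coe_toNNReal _ (sq_nonneg w)]

theorem emgf_mul_of_isStdCTS (hα0 : 0 < α) (hα2 : α < 2) (hlp : 0 < lp) (hlm : 0 < lm)
    (hw : 0 < w) (hρ : IsStdCTS α (lp * w) (lm * w) ρ) (hs : s ∈ Icc (-lm) lp) :
    emgf (fun x => w * x) ρ s = ENNReal.ofReal (Real.exp (w ^ 2 * PhiH α lp lm s)) := by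
  have := hρ.1
  have hlmlp : -lm < lp := (neg_lt_zero.2 hlm).trans hlp
  refine emgf_eq_of_mem_closure (f := fun u => w ^ 2 * PhiH α lp lm u) (by fun_prop)
    (convex_Ioo (-lm) lp) ?_ ?_ ?_ ?_
  · rw [interior_Ioo]
    exact ⟨neg_lt_zero.2 hlm, hlp⟩
  · rwa [closure_Ioo hlmlp.ne]
  · exact (continuous_const.mul (continuous_PhiH hα0.le hlp.ne' hlm.ne')).continuousAt
  · exact fun u hu => emgf_mul_of_isStdCTS_of_mem_Ioo hα0.ne' hα2 hlp hlm hw hρ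
      (interior_subset hu)

theorem emgf_mul_of_isStdCTS_of_notMem (hα0 : α ≠ 0) (hα2 : α < 2) (hlp : 0 < lp) (hlm : 0 < lm)
    (hw : 0 < w) (hρ : IsStdCTS α (lp * w) (lm * w) ρ) (hs : s ∉ Icc (-lm) lp) :
    emgf (fun x => w * x) ρ s = ⊤ :=
  emgf_eq_top_of_notMem_Icc hα0 hα2 hlp hlm (pow_pos hw 2) (by fun_prop)
    (fun _ => emgf_mul_of_isStdCTS_of_mem_Ioo hα0 hα2 hlp hlm hw hρ) hs

end StdCTS

section GammaLaw

theorem lintegral_rpow_mul_exp_neg_mul_Ioi_lt_top_iff {a r : ℝ} (ha : 0 < a) :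
    ∫⁻ x in Ioi (0 : ℝ), ENNReal.ofReal (x ^ (a - 1) * Real.exp (-(r * x))) < ⊤ ↔ 0 < r := by
  refine ⟨fun hfin => ?_,
    fun hr => lintegral_rpow_mul_exp_neg_mul_Ioi ha hr ▸ ENNReal.ofReal_lt_top⟩
  by_contra! hr
  have hpow : ∀ x ∈ Ioi (0 : ℝ), 0 ≤ x ^ (a - 1) := fun x hx => Real.rpow_nonneg (le_of_lt hx) _
  have hle : ∫⁻ x in Ioi (0 : ℝ), ENNReal.ofReal (x ^ (a - 1)) ≤
      ∫⁻ x in Ioi (0 : ℝ), ENNReal.ofReal (x ^ (a - 1) * Real.exp (-(r * x))) :=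
    setLIntegral_mono' measurableSet_Ioi fun x hx =>
      ENNReal.ofReal_le_ofReal <| le_mul_of_one_le_right (hpow x hx) <|
        Real.one_le_exp <| neg_nonneg.2 <| mul_nonpos_of_nonpos_of_nonneg hr (le_of_lt hx)
  refine not_integrableOn_Ioi_rpow (a - 1) ((lintegral_ofReal_ne_top_iff_integrable
    (Measurable.aestronglyMeasurable (by fun_prop)) ?_).1 (hle.trans_lt hfin).ne)
  exact (ae_restrict_iff' measurableSet_Ioi).2 (ae_of_all _ hpow)

variable {a b : ℝ}

theorem emgf_id_gammaMeasure (ha : 0 < a) (hb : 0 < b) (s : ℝ) :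
    emgf id (gammaMeasure a b) s = ENNReal.ofReal (b ^ a / Real.Gamma a) *
      ∫⁻ x in Ioi (0 : ℝ), ENNReal.ofReal (x ^ (a - 1) * Real.exp (-((b - s) * x))) := by
  have hpdf : Measurable (gammaPDF a b) := (measurable_gammaPDFReal a b).ennreal_ofReal
  have hneg : ∀ x ∈ Iio (0 : ℝ), gammaPDF a b x * ENNReal.ofReal (Real.exp (s * x)) = 0 :=
    fun x hx => by rw [gammaPDF_of_neg hx, zero_mul]
  have hpos : ∀ x ∈ Ici (0 : ℝ), gammaPDF a b x * ENNReal.ofReal (Real.exp (s * x)) =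
      ENNReal.ofReal (b ^ a / Real.Gamma a) *
        ENNReal.ofReal (x ^ (a - 1) * Real.exp (-((b - s) * x))) := fun x hx => by
    rw [gammaPDF_of_nonneg hx, ← ENNReal.ofReal_mul' (Real.exp_nonneg _),
      ← ENNReal.ofReal_mul (by positivity), mul_assoc, ← Real.exp_add, ← mul_assoc]
    ring_nf
  simp only [emgf, id, gammaMeasure]
  rw [lintegral_withDensity_eq_lintegral_mul _ hpdf (by fun_prop)]
  simp only [Pi.mul_apply]
  rw [← lintegral_add_compl _ measurableSet_Iio, setLIntegral_congr_fun measurableSet_Iio hneg,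
    lintegral_zero, zero_add, compl_Iio, setLIntegral_congr_fun measurableSet_Ici hpos,
    lintegral_const_mul _ (by fun_prop), setLIntegral_congr Ioi_ae_eq_Ici.symm]

theorem emgf_id_gammaMeasure_lt_top_iff (ha : 0 < a) (hb : 0 < b) {s : ℝ} :
    emgf id (gammaMeasure a b) s < ⊤ ↔ s < b := by
  have hc : ENNReal.ofReal (b ^ a / Real.Gamma a) ≠ 0 :=
    (ENNReal.ofReal_pos.2 (by positivity)).ne'
  rw [emgf_id_gammaMeasure ha hb, ← sub_pos (a := b),
    ← lintegral_rpow_mul_exp_neg_mul_Ioi_lt_top_iff ha]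
  exact ⟨fun h => ENNReal.lt_top_of_mul_ne_top_right h.ne hc,
    ENNReal.mul_lt_top ENNReal.ofReal_lt_top⟩

theorem fundamentalStrip_of_map_eq_gammaMeasure {Ω : Type*} [MeasurableSpace Ω] {P : Measure Ω}
    {V : Ω → ℝ} (hV : AEMeasurable V P) (ha : 0 < a) (hb : 0 < b)
    (hlaw : P.map V = gammaMeasure a b) : fundamentalStrip P V = {u : ℂ | u.re < b} := by
  ext u
  rw [mem_fundamentalStrip_iff, ← emgf_id_map hV, hlaw, emgf_id_gammaMeasure_lt_top_iff ha hb,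
    mem_ofPred_eq]

end GammaLaw

section Mixture

variable {Ω : Type*} [MeasurableSpace Ω] {P : Measure Ω}

theorem emgf_eq_lintegral_condDistrib [IsFiniteMeasure P] {V X : Ω → ℝ} (hV : AEMeasurable V P)
    (hX : AEMeasurable X P) {F : ℝ → ℝ → ℝ} (hF : Measurable F.uncurry) (s : ℝ) :
    emgf (fun ω => F (V ω) (X ω)) P s = ∫⁻ v, emgf (F v) (condDistrib X V P v) s ∂(P.map V) := by
  have hmeas : Measurable fun q : ℝ × ℝ => ENNReal.ofReal (Real.exp (s * F.uncurry q)) := by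
    fun_prop
  calc emgf (fun ω => F (V ω) (X ω)) P s
      = ∫⁻ q, ENNReal.ofReal (Real.exp (s * F.uncurry q)) ∂(P.map fun ω => (V ω, X ω)) :=
        (lintegral_map' hmeas.aemeasurable (hV.prodMk hX)).symm
    _ = ∫⁻ v, emgf (F v) (condDistrib X V P v) s ∂(P.map V) := by
        rw [← compProd_map_condDistrib hX, Measure.lintegral_compProd hmeas]
        rfl

variable [IsProbabilityMeasure P] {μ β α lp lm b s : ℝ} {V X Y : Ω → ℝ}

theorem emgf_mixedTS (hY : IsMixedTS P μ β α lp lm V X Y) (s : ℝ) :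
    emgf Y P s = ∫⁻ v, emgf (fun x => √v * x) (condDistrib X V P v) s *
      ENNReal.ofReal (Real.exp (s * (μ + β * v))) ∂(P.map V) := by
  have hYF : Y =ᵐ[P] fun ω => √(V ω) * X ω + (μ + β * V ω) :=
    hY.eq_Y.mono fun ω hω => hω.trans (add_comm _ _)
  rw [emgf_congr_ae hYF, emgf_eq_lintegral_condDistrib (F := fun v x => √v * x + (μ + β * v))
    hY.measurable_V.aemeasurable hY.measurable_X.aemeasurable
    (by unfold Function.uncurry; fun_prop)]
  exact lintegral_congr fun v => emgf_add_const (by fun_prop) _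

theorem ae_pos_map_mixing (hY : IsMixedTS P μ β α lp lm V X Y) : ∀ᵐ v ∂(P.map V), 0 < v :=
  (ae_map_iff hY.measurable_V.aemeasurable measurableSet_Ioi).2 hY.pos_V

theorem emgf_mixedTS_of_mem_Icc (hα0 : 0 < α) (hα2 : α < 2) (hlp : 0 < lp) (hlm : 0 < lm)
    (hY : IsMixedTS P μ β α lp lm V X Y) (hs : s ∈ Icc (-lm) lp) :
    emgf Y P s = ENNReal.ofReal (Real.exp (s * μ)) * emgf V P (β * s + PhiH α lp lm s) := by
  have hcond : ∀ᵐ v ∂(P.map V), emgf (fun x => √v * x) (condDistrib X V P v) s *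
        ENNReal.ofReal (Real.exp (s * (μ + β * v))) =
      ENNReal.ofReal (Real.exp (s * μ)) *
        ENNReal.ofReal (Real.exp ((β * s + PhiH α lp lm s) * v)) := by
    filter_upwards [ae_pos_map_mixing hY, hY.cond_X] with v hv hρ
    rw [emgf_mul_of_isStdCTS hα0 hα2 hlp hlm (Real.sqrt_pos.2 hv) hρ hs, Real.sq_sqrt hv.le,
      ← ENNReal.ofReal_mul (Real.exp_nonneg _), ← ENNReal.ofReal_mul (Real.exp_nonneg _),
      ← Real.exp_add, ← Real.exp_add]
    ring_nf
  rw [emgf_mixedTS hY, lintegral_congr_ae hcond, lintegral_const_mul _ (by fun_prop),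
    ← emgf_id_map hY.measurable_V.aemeasurable]
  rfl

theorem emgf_mixedTS_of_notMem_Icc (hα0 : α ≠ 0) (hα2 : α < 2) (hlp : 0 < lp) (hlm : 0 < lm)
    (hY : IsMixedTS P μ β α lp lm V X Y) (hs : s ∉ Icc (-lm) lp) : emgf Y P s = ⊤ := by
  have hcond : ∀ᵐ v ∂(P.map V), emgf (fun x => √v * x) (condDistrib X V P v) s *
      ENNReal.ofReal (Real.exp (s * (μ + β * v))) = ⊤ := by
    filter_upwards [ae_pos_map_mixing hY, hY.cond_X] with v hv hρ
    rw [emgf_mul_of_isStdCTS_of_notMem hα0 hα2 hlp hlm (Real.sqrt_pos.2 hv) hρ hs,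
      ENNReal.top_mul (ENNReal.ofReal_pos.2 (Real.exp_pos _)).ne']
  have := Measure.isProbabilityMeasure_map (μ := P) hY.measurable_V.aemeasurable
  rw [emgf_mixedTS hY, lintegral_congr_ae hcond, lintegral_const, measure_univ, mul_one]

theorem fundamentalStrip_mixedTS (hα0 : 0 < α) (hα2 : α < 2) (hlp : 0 < lp) (hlm : 0 < lm)
    (hY : IsMixedTS P μ β α lp lm V X Y) (hV : fundamentalStrip P V = {u : ℂ | u.re < b}) :
    fundamentalStrip P Y = Complex.re ⁻¹' {s ∈ Icc (-lm) lp | β * s + PhiH α lp lm s < b} := by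
  have hVlt : ∀ c : ℝ, emgf V P c < ⊤ ↔ c < b := fun c => by
    simpa only [hV, mem_ofPred_eq, Complex.ofReal_re] using
      (mem_fundamentalStrip_iff (P := P) (X := V) (u := (c : ℂ))).symm
  ext u
  rw [mem_fundamentalStrip_iff, mem_preimage, mem_ofPred_eq]
  by_cases hs : u.re ∈ Icc (-lm) lp
  · rw [emgf_mixedTS_of_mem_Icc hα0 hα2 hlp hlm hY hs, ← hVlt, and_iff_right hs]
    exact ⟨fun h => ENNReal.lt_top_of_mul_ne_top_right h.ne
        (ENNReal.ofReal_pos.2 (Real.exp_pos _)).ne', ENNReal.mul_lt_top ENNReal.ofReal_lt_top⟩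
  · simp only [emgf_mixedTS_of_notMem_Icc hα0.ne' hα2 hlp hlm hY hs, lt_self_iff_false, hs,
      false_and]

end Mixture

section ConvexLevelSets

variable {g : ℝ → ℝ} {a c x b : ℝ}

theorem sublevel_eq_Icc_of_convexOn (hg : ConvexOn ℝ (Icc a c) g) (ha : g a < b) (hc : g c < b) :
    {u ∈ Icc a c | g u < b} = Icc a c :=
  sep_eq_self_iff_mem_true.2 fun _ hu =>
    (hg.le_max_of_mem_Icc (left_mem_Icc.2 (hu.1.trans hu.2)) (right_mem_Icc.2 (hu.1.trans hu.2))
      hu).trans_lt (max_lt ha hc)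

theorem exists_level_eq_singleton_of_convexOn_right (hac : a ≤ c) (hg : ConvexOn ℝ (Icc a c) g)
    (hcont : ContinuousOn g (Icc a c)) (ha : g a < b) (hc : b < g c) :
    ∃ r ∈ Ioo a c, {u ∈ Icc a c | g u = b} = {r} ∧ {u ∈ Icc a c | g u < b} = Ico a r := by
  obtain ⟨r, hr, rfl⟩ := intermediate_value_Ioo hac hcont ⟨ha, hc⟩
  have haI : a ∈ Icc a c := left_mem_Icc.2 hac
  have hleft : ∀ u ∈ Ico a r, g u < g r := fun u hu => by
    rcases hu.1.eq_or_lt with rfl | hau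
    · exact ha
    · by_contra! hle
      exact (hg.lt_right_of_left_lt haI (Ioo_subset_Icc_self hr)
        (Ioo_subset_openSegment ⟨hau, hu.2⟩) (ha.trans_le hle)).not_ge hle
  have hright : ∀ u ∈ Ioc r c, g r < g u := fun u hu =>
    hg.lt_right_of_left_lt haI ⟨(hr.1.trans hu.1).le, hu.2⟩
      (Ioo_subset_openSegment ⟨hr.1, hu.1⟩) ha
  refine ⟨r, hr, ?_, ?_⟩ <;> ext u
  · refine ⟨fun ⟨hu, hgu⟩ => ?_, by
      rintro rfl
      exact ⟨Ioo_subset_Icc_self hr, rfl⟩⟩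
    rcases lt_trichotomy u r with h | h | h
    · exact absurd hgu (hleft u ⟨hu.1, h⟩).ne
    · exact h
    · exact absurd hgu (hright u ⟨h, hu.2⟩).ne'
  · refine ⟨fun ⟨hu, hgu⟩ => ⟨hu.1, ?_⟩,
      fun hu => ⟨⟨hu.1, (hu.2.trans hr.2).le⟩, hleft u hu⟩⟩
    by_contra! h
    rcases h.eq_or_lt with rfl | h
    · exact lt_irrefl _ hgu
    · exact hgu.not_gt (hright u ⟨h, hu.2⟩)

theorem exists_level_eq_singleton_of_convexOn_left (hac : a ≤ c) (hg : ConvexOn ℝ (Icc a c) g)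
    (hcont : ContinuousOn g (Icc a c)) (ha : b < g a) (hc : g c < b) :
    ∃ r ∈ Ioo a c, {u ∈ Icc a c | g u = b} = {r} ∧ {u ∈ Icc a c | g u < b} = Ioc r c := by
  have hIcc : Neg.neg ⁻¹' Icc a c = Icc (-c) (-a) := neg_Icc a c
  have hgneg : ConvexOn ℝ (Icc (-c) (-a)) (g ∘ Neg.neg) :=
    hIcc ▸ hg.comp_linearMap (-LinearMap.id)
  obtain ⟨r, hr, hlevel, hsub⟩ := exists_level_eq_singleton_of_convexOn_right (neg_le_neg hac)
    hgneg (hcont.comp continuousOn_neg hIcc.ge) (by simpa) (by simpa)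
  have hreflect : ∀ p : ℝ → Prop, {u ∈ Icc a c | p (g u)} =
      Neg.neg ⁻¹' {u ∈ Icc (-c) (-a) | p ((g ∘ Neg.neg) u)} := fun p => by
    ext u
    simp [and_comm]
  refine ⟨-r, ⟨lt_neg.1 hr.2, neg_lt.1 hr.1⟩, ?_, ?_⟩
  · rw [hreflect (· = b), hlevel]
    exact neg_singleton r
  · rw [hreflect (· < b), hsub]
    exact (neg_Ico (-c) r).trans (by rw [neg_neg])

theorem exists_level_eq_pair_of_convexOn (hx : x ∈ Icc a c) (hg : ConvexOn ℝ (Icc a c) g)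
    (hcont : ContinuousOn g (Icc a c)) (ha : b < g a) (hgx : g x < b) (hc : b < g c) :
    ∃ q r, q < r ∧ {u ∈ Icc a c | g u = b} = {q, r} ∧ {u ∈ Icc a c | g u < b} = Ioo q r := by
  have hsubl : Icc a x ⊆ Icc a c := Icc_subset_Icc_right hx.2
  have hsubr : Icc x c ⊆ Icc a c := Icc_subset_Icc_left hx.1
  obtain ⟨q, hq, hql, hqs⟩ := exists_level_eq_singleton_of_convexOn_left hx.1
    (hg.subset hsubl (convex_Icc a x)) (hcont.mono hsubl) ha hgx
  obtain ⟨r, hr, hrl, hrs⟩ := exists_level_eq_singleton_of_convexOn_right hx.2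
    (hg.subset hsubr (convex_Icc x c)) (hcont.mono hsubr) hgx hc
  have hsplit : ∀ p : ℝ → Prop,
      {u ∈ Icc a c | p u} = {u ∈ Icc a x | p u} ∪ {u ∈ Icc x c | p u} := fun p => by
    rw [← Icc_union_Icc_eq_Icc hx.1 hx.2]
    exact union_inter_distrib_right _ _ _
  refine ⟨q, r, hq.2.trans hr.1, ?_, ?_⟩
  · rw [hsplit, hql, hrl, singleton_union]
  · rw [hsplit, hqs, hrs, Ioc_union_Ico_eq_Ioo hq.2 hr.1]

end ConvexLevelSets

theorem convexOn_linear_add_PhiH {α lp lm : ℝ} (hα : 0 < α) (hlp : 0 < lp) (hlm : 0 < lm)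
    (β : ℝ) :
    ConvexOn ℝ (Icc (-lm) lp) fun u => β * u + PhiH α lp lm u :=
  ((LinearMap.mulLeft ℝ β).convexOn (convex_Icc _ _)).add (convexOn_PhiH hα hlp hlm)

end MixedTS

theorem theorem1 {Ω : Type*} [MeasurableSpace Ω] (P : Measure Ω) [IsProbabilityMeasure P]
    (μ β α lp lm b : ℝ) (hα0 : 0 < α) (hα2 : α < 2) (hlp : 0 < lp) (hlm : 0 < lm) (hb : 0 < b)
    (V X Y : Ω → ℝ) (hY : MixedTS.IsMixedTS P μ β α lp lm V X Y) :
    (∀ a : ℝ, 0 < a → P.map V = gammaMeasure a b →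
      MixedTS.fundamentalStrip P V = {u : ℂ | u.re < b}) ∧
    (MixedTS.fundamentalStrip P V = {u : ℂ | u.re < b} →
      (max (-β * lm + MixedTS.PhiH α lp lm (-lm)) (β * lp + MixedTS.PhiH α lp lm lp) < b →
        MixedTS.fundamentalStrip P Y = {u : ℂ | -lm ≤ u.re ∧ u.re ≤ lp}) ∧
      (-β * lm + MixedTS.PhiH α lp lm (-lm) < b ∧ b < β * lp + MixedTS.PhiH α lp lm lp →
        ∃ uₚ : ℝ, MixedTS.realSolutions β α lp lm b = {uₚ} ∧
          MixedTS.fundamentalStrip P Y = {u : ℂ | -lm ≤ u.re ∧ u.re < uₚ}) ∧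
      (b < -β * lm + MixedTS.PhiH α lp lm (-lm) ∧ β * lp + MixedTS.PhiH α lp lm lp < b →
        ∃ uₘ : ℝ, MixedTS.realSolutions β α lp lm b = {uₘ} ∧
          MixedTS.fundamentalStrip P Y = {u : ℂ | uₘ < u.re ∧ u.re ≤ lp}) ∧
      (b < min (-β * lm + MixedTS.PhiH α lp lm (-lm)) (β * lp + MixedTS.PhiH α lp lm lp) →
        ∃ uₘ uₚ : ℝ, uₘ < uₚ ∧ MixedTS.realSolutions β α lp lm b = {uₘ, uₚ} ∧
          MixedTS.fundamentalStrip P Y = {u : ℂ | uₘ < u.re ∧ u.re < uₚ})) := by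
  refine ⟨fun a ha hlaw => MixedTS.fundamentalStrip_of_map_eq_gammaMeasure
    hY.measurable_V.aemeasurable ha hb hlaw, fun hV => ?_⟩
  have hneglm : -lm < 0 := neg_lt_zero.2 hlm
  have hconv := MixedTS.convexOn_linear_add_PhiH hα0 hlp hlm β
  have hcont : Continuous fun u => β * u + MixedTS.PhiH α lp lm u :=
    (continuous_const_mul β).add (MixedTS.continuous_PhiH hα0.le hlp.ne' hlm.ne')
  have hzero : β * 0 + MixedTS.PhiH α lp lm 0 < b := by
    rwa [MixedTS.PhiH_zero α hlp.ne' hlm.ne', mul_zero, add_zero]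
  rw [MixedTS.fundamentalStrip_mixedTS hα0 hα2 hlp hlm hY hV, neg_mul_comm]
  refine ⟨fun h => ?_, fun ⟨hl, hr⟩ => ?_, fun ⟨hl, hr⟩ => ?_, fun h => ?_⟩
  · obtain ⟨hl, hr⟩ := max_lt_iff.1 h
    exact congrArg (Complex.re ⁻¹' ·) (MixedTS.sublevel_eq_Icc_of_convexOn hconv hl hr)
  · obtain ⟨r, -, hroot, hsub⟩ := MixedTS.exists_level_eq_singleton_of_convexOn_right
      (hneglm.trans hlp).le hconv hcont.continuousOn hl hr
    exact ⟨r, hroot, congrArg (Complex.re ⁻¹' ·) hsub⟩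
  · obtain ⟨r, -, hroot, hsub⟩ := MixedTS.exists_level_eq_singleton_of_convexOn_left
      (hneglm.trans hlp).le hconv hcont.continuousOn hl hr
    exact ⟨r, hroot, congrArg (Complex.re ⁻¹' ·) hsub⟩
  · obtain ⟨hl, hr⟩ := lt_min_iff.1 h
    obtain ⟨q, r, hqr, hroot, hsub⟩ := MixedTS.exists_level_eq_pair_of_convexOn
      ⟨hneglm.le, hlp.le⟩ hconv hcont.continuousOn hl hzero hr
    exact ⟨q, r, hqr, hroot, congrArg (Complex.re ⁻¹' ·) hsub⟩
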